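/- Let $d\ge 1$. For $f,g:\mathbb R^d\to\mathbb C$ put $T_xf(t)=f(t-x)$, $M_\omega f(t)=e^{2\pi i\,\omega\cdot t}f(t)$, $\tau(x,\omega)=M_\omega T_x$ and $\langle f,g\rangle=\int_{\mathbb R^d}f\,\overline g\,dx$. Let $S_0(\mathbb R^d)$ be Feichtinger's algebra, the set of all $g\in L^2(\mathbb R^d)$ for which $(x,\omega)\mapsto\langle g,\tau(x,\omega)g\rangle$ lies in $L^1(\mathbb R^{2d})$. For $1\le p,q\le\infty$ let $W(L^p,\ell^q)$ be the Wiener amalgam space of measurable functions on $\mathbb R^d$ (modulo equality almost everywhere) with finite norm $$\|f\|_{W(L^p,\ell^q)}=\Big(\sum_{k\in\mathbb Z^d}\|f\cdot\chi_{k+[0,1)^d}\|_p^q\Big)^{1/q}$$ (a supremum over $k$ if $q=\infty$), and let $B(W(L^p,\ell^q))$ be the space of bounded linear operators on it with the operator norm. Let $g,\gamma\in S_0(\mathbb R^d)$ with $\langle\gamma,g\rangle\ne0$, suppose that $\overline g\cdot\gamma$ is locally Riemann integrable (Riemann integrable on every compact box), and let $1\le p,q\le\infty$. Then for all $a,b>0$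 the Gabor series $$S_{a,b;g,\gamma}f=\frac{(ab)^d}{\langle\gamma,g\rangle}\sum_{n,m\in\mathbb Z^d}\langle f,\tau(na,mb)g\rangle\,\tau(na,mb)\gamma ,\qquad f\in W(L^p,\ell^q),$$ converging unconditionally in the sense of distributions (that is, after pairing with any $h\in C_c^\infty(\mathbb R^d)$), defines a unique operator $S_{a,b;g,\gamma}\in B(W(L^p,\ell^q))$; likewise for $S_{a,b;\gamma,g}$, in which $g$ and $\gamma$ are interchanged (also in the factor $\langle\gamma,g\rangle$). Moreover, with limits taken over $a,b>0$, the following conditions are equivalent: (i) $\displaystyle\lim_{(a,b)\to(0,0)}S_{a,b;g,\gamma}=\lim_{(a,b)\to(0,0)}S_{a,b;\gamma,g}=I$ in the operator norm of $B(W(L^p,\ell^q))$; (ii) $\displaystyle\lim_{(a,b)\to(0,0)}\frac1{\langle\gamma,g\rangle}\,\langle\gamma,M_{l/a}T_{n/b}\,g\rangle=\delta_{l0}\,\delta_{n0}$ for all $l,n\in\mathbb Z^d$. -/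

import Mathlib

open MeasureTheory Filter Topology
open scoped ENNReal ComplexConjugate

noncomputable section

namespace Gabor

/-! ### Time-frequency shifts and windows on `ℝ^d` -/

/-- The translation `T_x f (t) = f (t - x)`. -/
def transl {d : ℕ} (x : Fin d → ℝ) (f : (Fin d → ℝ) → ℂ) : (Fin d → ℝ) → ℂ :=
  fun t => f (t - x)

/-- The modulation `M_ξ f (t) = e^{2πi ξ·t} f (t)`. -/
def modul {d : ℕ} (ξ : Fin d → ℝ) (f : (Fin d → ℝ) → ℂ) : (Fin d → ℝ) → ℂ :=
  fun t => Complex.exp (2 * Real.pi * Complex.I * ((ξ ⬝ᵥ t : ℝ) : ℂ)) * f t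

/-- The time-frequency shift `τ(t, ξ) = M_ξ T_t`, that is
`(τ(t, ξ) g)(x) = g (x - t) e^{2πi x·ξ}`. -/
def tfShift {d : ℕ} (t ξ : Fin d → ℝ) (g : (Fin d → ℝ) → ℂ) : (Fin d → ℝ) → ℂ :=
  modul ξ (transl t g)

/-- The pairing `⟨f, g⟩ = ∫ f(x) conj (g(x)) dx`. -/
def pairing {d : ℕ} (f g : (Fin d → ℝ) → ℂ) : ℂ :=
  ∫ x, f x * conj (g x)

/-- The windowed Fourier transform `F_g f (t, ξ) = ⟨f, τ(t, ξ) g⟩`. -/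
def windowedFourier {d : ℕ} (g f : (Fin d → ℝ) → ℂ) :
    (Fin d → ℝ) × (Fin d → ℝ) → ℂ :=
  fun z => pairing f (tfShift z.1 z.2 g)

/-- Membership in Feichtinger's algebra `S₀(ℝ^d)`: `g ∈ L²(ℝ^d)` and `F_g g ∈ L¹(ℝ^{2d})`. -/
structure MemS0 {d : ℕ} (g : (Fin d → ℝ) → ℂ) : Prop where
  memLp_two : MemLp g 2 volume
  integrable_windowedFourier : Integrable (windowedFourier g g) volume

/-- `f` is Riemann integrable on every compact box of `ℝ^d`. -/
def LocallyRiemannIntegrable {d : ℕ} (f : (Fin d → ℝ) → ℂ) : Prop :=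
  ∀ I : BoxIntegral.Box (Fin d),
    BoxIntegral.Integrable I BoxIntegral.IntegrationParams.Riemann f
      (BoxIntegral.BoxAdditiveMap.volume : BoxIntegral.BoxAdditiveMap (Fin d) (ℂ →L[ℝ] ℂ) ⊤)

/-! ### Wiener amalgam spaces -/

/-- The translated unit cube `k + [0,1)^d`. -/
def cube {d : ℕ} (k : Fin d → ℤ) : Set (Fin d → ℝ) :=
  {x | ∀ i, (k i : ℝ) ≤ x i ∧ x i < k i + 1}

/-- The amalgam norm `(∑_k ‖f · χ_{k + [0,1)^d}‖_p ^ q)^{1/q}` (a supremum over `k` if `q = ∞`),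
with values in `[0, ∞]`. -/
def amalgamENorm {d : ℕ} (p q : ℝ≥0∞) (f : (Fin d → ℝ) → ℂ) : ℝ≥0∞ :=
  eLpNorm (fun k : Fin d → ℤ => eLpNorm ((cube k).indicator f) p volume) q Measure.count

theorem amalgamENorm_eq_tsum {d : ℕ} (p q : ℝ≥0∞) (hq0 : q ≠ 0) (hq : q ≠ ∞)
    (f : (Fin d → ℝ) → ℂ) :
    amalgamENorm p q f =
      (∑' k : Fin d → ℤ, eLpNorm ((cube k).indicator f) p volume ^ q.toReal) ^ (1 / q.toReal) := by
  rw [amalgamENorm, eLpNorm_eq_lintegral_rpow_enorm_toReal hq0 hq, lintegral_count]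
  simp

theorem amalgamENorm_top {d : ℕ} (p : ℝ≥0∞) (f : (Fin d → ℝ) → ℂ) :
    amalgamENorm p ∞ f = ⨆ k : Fin d → ℤ, eLpNorm ((cube k).indicator f) p volume := by
  rw [amalgamENorm, eLpNorm_exponent_top, eLpNormEssSup]
  simp

theorem measurableSet_cube {d : ℕ} (k : Fin d → ℤ) : MeasurableSet (cube k) := by
  have : cube k = Set.pi Set.univ fun i => Set.Ico (k i : ℝ) (k i + 1) := by
    ext x; simp [cube]
  rw [this]
  exact MeasurableSet.univ_pi fun i => measurableSet_Ico

theorem mem_cube_floor {d : ℕ} (x : Fin d → ℝ) : x ∈ cube fun i => ⌊x i⌋ :=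
  fun _ => ⟨Int.floor_le _, Int.lt_floor_add_one _⟩

theorem amalgamENorm_congr {d : ℕ} (p q : ℝ≥0∞) {f g : (Fin d → ℝ) → ℂ} (h : f =ᵐ[volume] g) :
    amalgamENorm p q f = amalgamENorm p q g := by
  unfold amalgamENorm
  congr 1
  funext k
  refine eLpNorm_congr_ae ?_
  filter_upwards [h] with x hx
  simp [Set.indicator, hx]

theorem amalgamENorm_add_le {d : ℕ} {p q : ℝ≥0∞} (hp : 1 ≤ p) (hq : 1 ≤ q)
    {f g : (Fin d → ℝ) → ℂ} (hf : AEStronglyMeasurable f volume)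
    (hg : AEStronglyMeasurable g volume) :
    amalgamENorm p q (f + g) ≤ amalgamENorm p q f + amalgamENorm p q g := by
  unfold amalgamENorm
  refine le_trans (eLpNorm_mono_enorm fun k => ?_)
    (eLpNorm_add_le (measurable_of_countable _).aestronglyMeasurable
      (measurable_of_countable _).aestronglyMeasurable hq)
  simp only [enorm_eq_self, Pi.add_apply]
  rw [Set.indicator_add']
  exact eLpNorm_add_le (hf.indicator (measurableSet_cube k)) (hg.indicator (measurableSet_cube k)) hp

theorem amalgamENorm_smul {d : ℕ} {p q : ℝ≥0∞} (hq0 : q ≠ 0) (c : ℂ) (f : (Fin d → ℝ) → ℂ) :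
    amalgamENorm p q (c • f) = ‖c‖ₑ * amalgamENorm p q f := by
  have key : ∀ k : Fin d → ℤ, eLpNorm ((cube k).indicator (c • f)) p volume =
      ‖c‖ₑ * eLpNorm ((cube k).indicator f) p volume := fun k => by
    have : (cube k).indicator (c • f) = c • (cube k).indicator f := by
      ext x; by_cases hx : x ∈ cube k <;> simp [hx]
    rw [this]
    exact eLpNorm_const_smul c _ p volume
  by_cases hq : q = ∞
  · subst hq
    simp_rw [amalgamENorm_top, key, ENNReal.mul_iSup]
  · have hpos : 0 < q.toReal := ENNReal.toReal_pos hq0 hq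
    rw [amalgamENorm_eq_tsum p q hq0 hq, amalgamENorm_eq_tsum p q hq0 hq]
    simp_rw [key, ENNReal.mul_rpow_of_nonneg _ _ hpos.le, ENNReal.tsum_mul_left]
    rw [ENNReal.mul_rpow_of_nonneg _ _ (by positivity), ← ENNReal.rpow_mul,
      mul_one_div_cancel hpos.ne', ENNReal.rpow_one]

theorem amalgamENorm_zero {d : ℕ} {p q : ℝ≥0∞} (hq0 : q ≠ 0) :
    amalgamENorm p q (0 : (Fin d → ℝ) → ℂ) = 0 := by
  simpa using amalgamENorm_smul (p := p) hq0 (0 : ℂ) (0 : (Fin d → ℝ) → ℂ)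

theorem ae_eq_zero_of_amalgamENorm {d : ℕ} {p q : ℝ≥0∞} (hp : 1 ≤ p) (hq : 1 ≤ q)
    {f : (Fin d → ℝ) → ℂ} (hf : AEStronglyMeasurable f volume) (h : amalgamENorm p q f = 0) :
    f =ᵐ[volume] 0 := by
  unfold amalgamENorm at h
  have hp0 : p ≠ 0 := (zero_lt_one.trans_le hp).ne'
  have hq0 : q ≠ 0 := (zero_lt_one.trans_le hq).ne'
  rw [eLpNorm_eq_zero_iff (measurable_of_countable _).aestronglyMeasurable hq0] at h
  have h2 : ∀ k : Fin d → ℤ, (cube k).indicator f =ᵐ[volume] 0 := fun k => by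
    have hk : eLpNorm ((cube k).indicator f) p volume = 0 := by
      rw [Filter.EventuallyEq, Measure.ae_count_iff] at h
      exact h k
    rwa [eLpNorm_eq_zero_iff (hf.indicator (measurableSet_cube k)) hp0] at hk
  filter_upwards [ae_all_iff.2 h2] with x hx
  have := hx fun i => ⌊x i⌋
  rwa [Set.indicator_of_mem (mem_cube_floor x)] at this

/-- The Wiener amalgam space `W(L^p, ℓ^q)` on `ℝ^d`: the classes of measurable functions, modulo
equality almost everywhere, with finite amalgam norm. -/
def Amalgam (d : ℕ) (p q : ℝ≥0∞) [hp : Fact (1 ≤ p)] [hq : Fact (1 ≤ q)] :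
    Submodule ℂ ((Fin d → ℝ) →ₘ[volume] ℂ) where
  carrier := {f | amalgamENorm p q f < ∞}
  zero_mem' := by
    have h0 : amalgamENorm p q ((0 : (Fin d → ℝ) →ₘ[volume] ℂ) : (Fin d → ℝ) → ℂ) = 0 := by
      rw [amalgamENorm_congr p q AEEqFun.coeFn_zero]
      exact amalgamENorm_zero (zero_lt_one.trans_le hq.out).ne'
    change amalgamENorm p q _ < ∞
    rw [h0]
    exact ENNReal.zero_lt_top
  add_mem' := fun {f g} hf hg => by
    simp only [Set.mem_ofPred_eq] at hf hg ⊢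
    rw [amalgamENorm_congr p q (AEEqFun.coeFn_add f g)]
    exact (amalgamENorm_add_le hp.out hq.out f.aestronglyMeasurable g.aestronglyMeasurable).trans_lt
      (ENNReal.add_lt_top.2 ⟨hf, hg⟩)
  smul_mem' := fun c f hf => by
    simp only [Set.mem_ofPred_eq] at hf ⊢
    rw [amalgamENorm_congr p q (AEEqFun.coeFn_smul c f),
      amalgamENorm_smul (zero_lt_one.trans_le hq.out).ne']
    exact ENNReal.mul_lt_top enorm_lt_top hf

instance Amalgam.instNorm (d : ℕ) (p q : ℝ≥0∞) [Fact (1 ≤ p)] [Fact (1 ≤ q)] :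
    Norm (Amalgam d p q) :=
  ⟨fun f => (amalgamENorm p q (f : (Fin d → ℝ) →ₘ[volume] ℂ)).toReal⟩

theorem Amalgam.normedSpaceCore (d : ℕ) (p q : ℝ≥0∞) [hp : Fact (1 ≤ p)] [hq : Fact (1 ≤ q)] :
    NormedSpace.Core ℂ (Amalgam d p q) where
  norm_nonneg f := ENNReal.toReal_nonneg
  norm_smul c f := by
    change (amalgamENorm p q ((c • (f : (Fin d → ℝ) →ₘ[volume] ℂ) :
      (Fin d → ℝ) →ₘ[volume] ℂ) : (Fin d → ℝ) → ℂ)).toReal = ‖c‖ * (amalgamENorm p q _).toReal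
    rw [amalgamENorm_congr p q (AEEqFun.coeFn_smul c _), amalgamENorm_smul (zero_lt_one.trans_le hq.out).ne',
      ENNReal.toReal_mul,
      toReal_enorm]
  norm_triangle f g := by
    change (amalgamENorm p q (((f : (Fin d → ℝ) →ₘ[volume] ℂ) + (g : (Fin d → ℝ) →ₘ[volume] ℂ) :
      (Fin d → ℝ) →ₘ[volume] ℂ) : (Fin d → ℝ) → ℂ)).toReal ≤
      (amalgamENorm p q _).toReal + (amalgamENorm p q _).toReal
    rw [amalgamENorm_congr p q (AEEqFun.coeFn_add _ _),
      ← ENNReal.toReal_add (ne_of_lt f.2) (ne_of_lt g.2)]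
    exact ENNReal.toReal_mono (ENNReal.add_ne_top.2 ⟨ne_of_lt f.2, ne_of_lt g.2⟩)
      (amalgamENorm_add_le hp.out hq.out (AEEqFun.aestronglyMeasurable _)
        (AEEqFun.aestronglyMeasurable _))
  norm_eq_zero_iff f := by
    constructor
    · intro h
      have h1 : amalgamENorm p q (f : (Fin d → ℝ) →ₘ[volume] ℂ) = 0 :=
        ((ENNReal.toReal_eq_zero_iff _).1 h).resolve_right (ne_of_lt f.2)
      have h2 := ae_eq_zero_of_amalgamENorm hp.out hq.out (AEEqFun.aestronglyMeasurable _) h1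
      exact Subtype.ext (AEEqFun.ext (h2.trans AEEqFun.coeFn_zero.symm))
    · rintro rfl
      change (amalgamENorm p q ((0 : (Fin d → ℝ) →ₘ[volume] ℂ) : (Fin d → ℝ) → ℂ)).toReal = 0
      rw [amalgamENorm_congr p q AEEqFun.coeFn_zero]
      rw [amalgamENorm_zero (zero_lt_one.trans_le hq.out).ne', ENNReal.toReal_zero]

instance Amalgam.instNormedAddCommGroup (d : ℕ) (p q : ℝ≥0∞) [Fact (1 ≤ p)] [Fact (1 ≤ q)] :
    NormedAddCommGroup (Amalgam d p q) :=
  NormedAddCommGroup.ofCore (Amalgam.normedSpaceCore d p q)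

instance Amalgam.instNormedSpace (d : ℕ) (p q : ℝ≥0∞) [Fact (1 ≤ p)] [Fact (1 ≤ q)] :
    NormedSpace ℂ (Amalgam d p q) :=
  NormedSpace.ofCore (Amalgam.normedSpaceCore d p q)

/-! ### Gabor frame operators -/

/-- The lattice point `c k` of `c ℤ^d`. -/
def latticePt {d : ℕ} (c : ℝ) (k : Fin d → ℤ) : Fin d → ℝ :=
  fun i => c * k i

/-- `u` is the sum of the Gabor series
`(ab)^d / ⟨γ, g⟩ ∑_{n,m} ⟨f, τ(na, mb) g⟩ τ(na, mb) γ`,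
where the double series converges unconditionally in the sense of distributions: after pairing
with an arbitrary smooth compactly supported function. -/
def HasGaborSum {d : ℕ} (a b : ℝ) (g γ f u : (Fin d → ℝ) → ℂ) : Prop :=
  ∀ h : (Fin d → ℝ) → ℂ, ContDiff ℝ (⊤ : ℕ∞) h → HasCompactSupport h →
    HasSum (fun nm : (Fin d → ℤ) × (Fin d → ℤ) =>
      ((a * b : ℝ) : ℂ) ^ d / pairing γ g *
        (pairing f (tfShift (latticePt a nm.1) (latticePt b nm.2) g) *
          pairing (tfShift (latticePt a nm.1) (latticePt b nm.2) γ) h))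
      (pairing u h)

/-- The bounded operator `S` on `W(L^p, ℓ^q)` is given by the Gabor series. -/
def IsGaborFrameOperator {d : ℕ} {p q : ℝ≥0∞} [Fact (1 ≤ p)] [Fact (1 ≤ q)]
    (a b : ℝ) (g γ : (Fin d → ℝ) → ℂ) (S : Amalgam d p q →L[ℂ] Amalgam d p q) : Prop :=
  ∀ f : Amalgam d p q, HasGaborSum a b g γ
    (f : (Fin d → ℝ) →ₘ[volume] ℂ) (S f : (Fin d → ℝ) →ₘ[volume] ℂ)

/-- The Gabor frame operator `S_{a,b;g,γ}` in `B(W(L^p, ℓ^q))`: the bounded operator given by the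
Gabor series (an arbitrary operator if there is none). -/
def gaborFrameOperator {d : ℕ} (p q : ℝ≥0∞) [Fact (1 ≤ p)] [Fact (1 ≤ q)]
    (a b : ℝ) (g γ : (Fin d → ℝ) → ℂ) : Amalgam d p q →L[ℂ] Amalgam d p q :=
  Classical.epsilon (IsGaborFrameOperator a b g γ)

end Gabor

end

/-! The equivalence holds because, for windows in `S₀`, both conditions are true. Everything rests
on Janssen's representation `S_{a,b;g,γ} = ⟨γ,g⟩⁻¹ ∑_{n,l} V(n/b, l/a) τ(n/b, l/a)`, where `V =
windowedFourier g γ`. Its term at the origin is the identity, and each shift has norm at most `2^d`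
on the amalgam space, so `‖S - I‖ ≤ 2^d |⟨γ,g⟩|⁻¹ ∑_{(n,l) ≠ 0} |V(n/b, l/a)|`. As `a, b → 0` the
adjoint lattice spreads out and this sum tends to zero. Each off-origin coefficient in (ii) is one
term of the same sum.

Integrability of `V` alone does not control lattice samples. The substitute is `HasDecay`: `|V|` is
pointwise at most a finite measure convolved with `(1 + ‖z‖)^{-N}`. It is obtained by writing a
nonzero `g ∈ S₀` as an integrable superposition of time-frequency shifts of one test function
(`MemS0.exists_isSynthesis`). Windowed transforms of test functions decay rapidly, and superposition
turns this into convolution with a finite measure (`IsSynthesis.hasDecay_windowedFourier`). Weights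
can be summed over lattices uniformly in the translate, and dominated convergence in the measure
gives the limit (`HasDecay.tendsto_tsum_ne_zero`).

Janssen's representation is proved weakly, against test functions (`hasSum_gabor`). Poisson
summation over the modulations, and separately over the adjoint modulations, expresses the two sides
by the same doubly indexed family of integrals of `gaborKernel`, which is absolutely summable. Since
the operator norms of Janssen's terms are summable and the amalgam space is complete, the series
defines a bounded operator; test functions separate points of the space, so it is unique. -/

namespace Gabor

variable {d : ℕ}

/-! ### Characters and time-frequency shifts -/

/-- The character `x ↦ e^{2πi ξ·x}`. -/
noncomputable def chr (ξ x : Fin d → ℝ) : ℂ :=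
  Complex.exp (2 * Real.pi * Complex.I * ((ξ ⬝ᵥ x : ℝ) : ℂ))

theorem chr_eq (ξ x : Fin d → ℝ) :
    chr ξ x = Complex.exp (((2 * Real.pi * (ξ ⬝ᵥ x) : ℝ) : ℂ) * Complex.I) := by
  unfold chr; congr 1; push_cast; ring

@[simp] theorem norm_chr (ξ x : Fin d → ℝ) : ‖chr ξ x‖ = 1 := by
  rw [chr_eq, Complex.norm_exp_ofReal_mul_I]

@[simp] theorem enorm_chr (ξ x : Fin d → ℝ) : ‖chr ξ x‖ₑ = 1 := by
  rw [← ofReal_norm, norm_chr, ENNReal.ofReal_one]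

theorem conj_chr (ξ x : Fin d → ℝ) : conj (chr ξ x) = chr ξ (-x) := by
  rw [chr_eq, chr_eq, ← Complex.exp_conj, map_mul, Complex.conj_ofReal, Complex.conj_I,
    dotProduct_neg]
  congr 1; push_cast; ring

theorem chr_neg_left (ξ x : Fin d → ℝ) : chr (-ξ) x = conj (chr ξ x) := by
  rw [conj_chr]; simp [chr]

theorem chr_add_right (ξ x y : Fin d → ℝ) : chr ξ (x + y) = chr ξ x * chr ξ y := by
  rw [chr, chr, chr, ← Complex.exp_add, dotProduct_add]; congr 1; push_cast; ring

theorem chr_sub_right (ξ x y : Fin d → ℝ) : chr ξ (x - y) = chr ξ x * conj (chr ξ y) := by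
  rw [conj_chr, ← chr_add_right, sub_eq_add_neg]

theorem chr_add_left (ξ η x : Fin d → ℝ) : chr (ξ + η) x = chr ξ x * chr η x := by
  rw [chr, chr, chr, ← Complex.exp_add, add_dotProduct]; congr 1; push_cast; ring

@[simp] theorem chr_zero_left (x : Fin d → ℝ) : chr 0 x = 1 := by simp [chr]

theorem continuous_chr : Continuous fun z : (Fin d → ℝ) × (Fin d → ℝ) => chr z.1 z.2 := by
  unfold chr dotProduct
  fun_prop

@[fun_prop]
theorem _root_.Continuous.gaborChr {X : Type*} [TopologicalSpace X] {f g : X → Fin d → ℝ}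
    (hf : Continuous f) (hg : Continuous g) : Continuous fun x => chr (f x) (g x) :=
  continuous_chr.comp (hf.prodMk hg)

theorem tfShift_apply (t ξ x : Fin d → ℝ) (g : (Fin d → ℝ) → ℂ) :
    tfShift t ξ g x = chr ξ x * g (x - t) := rfl

theorem transl_apply (t x : Fin d → ℝ) (g : (Fin d → ℝ) → ℂ) : transl t g x = g (x - t) := rfl

theorem transl_congr_ae (t : Fin d → ℝ) {g g' : (Fin d → ℝ) → ℂ} (h : g =ᵐ[volume] g') :
    transl t g =ᵐ[volume] transl t g' :=
  (measurePreserving_sub_right volume t).quasiMeasurePreserving.ae_eq_comp h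

theorem tfShift_congr_ae (t ξ : Fin d → ℝ) {g g' : (Fin d → ℝ) → ℂ} (h : g =ᵐ[volume] g') :
    tfShift t ξ g =ᵐ[volume] tfShift t ξ g' := by
  filter_upwards [transl_congr_ae t h] with x hx
  rw [transl_apply, transl_apply] at hx
  rw [tfShift_apply, tfShift_apply, hx]

theorem pairing_congr_ae {f f' g g' : (Fin d → ℝ) → ℂ} (hf : f =ᵐ[volume] f')
    (hg : g =ᵐ[volume] g') : pairing f g = pairing f' g' := by
  refine integral_congr_ae ?_
  filter_upwards [hf, hg] with x h1 h2
  rw [h1, h2]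

theorem pairing_conj (f g : (Fin d → ℝ) → ℂ) : conj (pairing f g) = pairing g f := by
  unfold pairing
  rw [← integral_conj]
  congr 1; ext x; simp [mul_comm]

theorem norm_pairing_comm (f g : (Fin d → ℝ) → ℂ) : ‖pairing f g‖ₑ = ‖pairing g f‖ₑ := by
  rw [← pairing_conj, RCLike.enorm_conj]

theorem enorm_pairing_const_mul_right (f g : (Fin d → ℝ) → ℂ) {c : ℂ} (hc : ‖c‖ₑ = 1) :
    ‖pairing f (fun x => c * g x)‖ₑ = ‖pairing f g‖ₑ := by
  have : pairing f (fun x => c * g x) = conj c * pairing f g := by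
    unfold pairing
    rw [← integral_const_mul]
    congr 1; ext x; simp; ring
  rw [this, enorm_mul, RCLike.enorm_conj, hc, one_mul]

theorem pairing_tfShift_right (f g : (Fin d → ℝ) → ℂ) (t ξ : Fin d → ℝ) :
    pairing f (tfShift t ξ g) = conj (chr ξ t) * pairing (tfShift (-t) (-ξ) f) g := by
  unfold pairing
  rw [← integral_const_mul, ← integral_add_right_eq_self _ t]
  congr 1; ext x
  simp only [tfShift_apply, map_mul, chr_add_right, chr_neg_left, add_sub_cancel_right,
    sub_neg_eq_add]
  ring

theorem tfShift_tfShift (t ξ t' ξ' : Fin d → ℝ) (g : (Fin d → ℝ) → ℂ) :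
    tfShift t ξ (tfShift t' ξ' g) = fun x => conj (chr ξ' t) * tfShift (t + t') (ξ + ξ') g x := by
  ext x
  simp only [tfShift_apply, chr_sub_right, chr_add_left, sub_sub]
  ring

theorem enorm_pairing_tfShift_right (f g : (Fin d → ℝ) → ℂ) (t ξ : Fin d → ℝ) :
    ‖pairing f (tfShift t ξ g)‖ₑ = ‖pairing (tfShift (-t) (-ξ) f) g‖ₑ := by
  rw [pairing_tfShift_right, enorm_mul, RCLike.enorm_conj, enorm_chr, one_mul]

theorem enorm_pairing_tfShift_tfShift (f g : (Fin d → ℝ) → ℂ) (t ξ t' ξ' : Fin d → ℝ) :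
    ‖pairing (tfShift t ξ f) (tfShift t' ξ' g)‖ₑ =
      ‖pairing f (tfShift (t' - t) (ξ' - ξ) g)‖ₑ := by
  rw [norm_pairing_comm, enorm_pairing_tfShift_right, norm_pairing_comm, tfShift_tfShift,
    enorm_pairing_const_mul_right _ _ (by simp), neg_add_eq_sub, neg_add_eq_sub]

/-! ### Fourier inversion almost everywhere -/

/-- This is Schwartz inversion, carried over from Euclidean space to `Fin d → ℝ`. The two spaces
differ in norm but share Lebesgue measure, so `toLp` transports every integral. -/
theorem exists_integrable_fourier_eq {h : (Fin d → ℝ) → ℂ} (hh : ContDiff ℝ (⊤ : ℕ∞) h)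
    (hc : HasCompactSupport h) :
    Integrable (fun ω => ∫ y, h y * chr ω y) ∧
      ∀ x, ∫ ω, (∫ y, h y * chr ω y) * conj (chr ω x) = h x := by
  set E := EuclideanSpace ℝ (Fin d)
  have hch : ContDiff ℝ (⊤ : ℕ∞) fun x : E => h (WithLp.ofLp x) :=
    hh.comp (PiLp.contDiff_ofLp)
  have hcc : HasCompactSupport fun x : E => h (WithLp.ofLp x) :=
    hc.comp_homeomorph (PiLp.homeomorph 2 _)
  set H := hcc.toSchwartzMap hch
  have hH : ∀ x, H (WithLp.toLp 2 x) = h x := fun x => rfl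
  have hinv : FourierTransform.fourier (FourierTransformInv.fourierInv H) = H :=
    FourierTransform.fourier_fourierInv_eq H
  have key : ∀ ω : Fin d → ℝ, (FourierTransformInv.fourierInv H) (WithLp.toLp 2 ω) =
      ∫ y, h y * chr ω y := by
    intro ω
    rw [SchwartzMap.fourierInv_coe, Real.fourierInv_eq',
      ← (PiLp.volume_preserving_toLp (Fin d)).integral_comp
        (MeasurableEquiv.toLp 2 (Fin d → ℝ)).measurableEmbedding]
    congr 1; ext y
    rw [hH, smul_eq_mul, mul_comm, chr_eq]
    congr 3
  constructor
  · have := (FourierTransformInv.fourierInv H).integrable (μ := volume)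
    rw [← (PiLp.volume_preserving_toLp (Fin d)).integrable_comp_emb
      (MeasurableEquiv.toLp 2 (Fin d → ℝ)).measurableEmbedding] at this
    refine this.congr (ae_of_all _ fun ω => ?_)
    exact key ω
  · intro x
    rw [← hH, ← hinv, SchwartzMap.fourier_coe, Real.fourier_eq',
      ← (PiLp.volume_preserving_toLp (Fin d)).integral_comp
        (MeasurableEquiv.toLp 2 (Fin d → ℝ)).measurableEmbedding]
    congr 1; ext ω
    have hin : inner ℝ (WithLp.toLp 2 ω : E) (WithLp.toLp 2 x) = ω ⬝ᵥ x := by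
      simp only [PiLp.inner_apply, dotProduct, RCLike.inner_apply, conj_trivial, mul_comm]
    rw [← key, smul_eq_mul, mul_comm, conj_chr, chr_eq]
    simp only [hin, dotProduct_neg, mul_neg, neg_mul]

theorem integrable_mul_chr {F : (Fin d → ℝ) → ℂ} (hF : Integrable F) (ξ : Fin d → ℝ) :
    Integrable fun x => F x * chr ξ x :=
  hF.mul_bdd (c := 1) (by fun_prop) (ae_of_all _ fun x => (norm_chr ξ x).le)

theorem continuous_integral_mul_chr {F : (Fin d → ℝ) → ℂ} (hF : Integrable F) :
    Continuous fun ω => ∫ x, F x * chr x ω := by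
  refine continuous_of_dominated (bound := fun x => ‖F x‖) (fun ω => ?_) (fun ω => ?_) hF.norm ?_
  · exact hF.1.mul (by fun_prop)
  · exact ae_of_all _ fun x => by simp
  · exact ae_of_all _ fun x => by fun_prop

/-- The Fourier inversion formula for an integrable function with integrable Fourier transform. -/
theorem ae_eq_integral_fourier {F : (Fin d → ℝ) → ℂ} (hF : Integrable F)
    (hG : Integrable fun ω => ∫ x, F x * conj (chr ω x)) :
    F =ᵐ[volume] fun x => ∫ ω, (∫ y, F y * conj (chr ω y)) * chr ω x := by
  set G : (Fin d → ℝ) → ℂ := fun ω => ∫ x, F x * conj (chr ω x)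
  have hQ : Continuous fun x => ∫ ω, G ω * chr ω x := continuous_integral_mul_chr hG
  refine ae_eq_of_integral_contDiff_smul_eq hF.locallyIntegrable hQ.locallyIntegrable
    fun r hr hrc => ?_
  set h : (Fin d → ℝ) → ℂ := fun x => (r x : ℂ)
  have hh : ContDiff ℝ (⊤ : ℕ∞) h := Complex.ofRealCLM.contDiff.comp hr
  have hhc : HasCompactSupport h := hrc.comp_left Complex.ofReal_zero
  obtain ⟨hK, hKh⟩ := exists_integrable_fourier_eq hh hhc
  set K : (Fin d → ℝ) → ℂ := fun ω => ∫ y, h y * chr ω y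
  have hhi : Integrable h := hh.continuous.integrable_of_hasCompactSupport hhc
  -- Tested against `r`, both functions give `∫ K G`: on the left `r` is expanded by its own
  -- inversion formula, on the right the definition is inserted, and Fubini does the rest.
  have e1 : ∫ x, r x • F x = ∫ x, ∫ ω, F x * K ω * conj (chr ω x) := by
    congr 1; ext x
    rw [Complex.real_smul, ← show _ = (r x : ℂ) from hKh x, mul_comm, ← integral_const_mul]
    simp_rw [mul_assoc]
    rfl
  have e2 : ∫ x, r x • ∫ ω, G ω * chr ω x = ∫ x, ∫ ω, h x * G ω * chr ω x := by
    congr 1; ext x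
    rw [Complex.real_smul, ← integral_const_mul]
    simp_rw [mul_assoc]
    rfl
  have s1 : Integrable (fun z : (Fin d → ℝ) × (Fin d → ℝ) => F z.1 * K z.2 * conj (chr z.2 z.1))
      (volume.prod volume) := by
    refine (hF.mul_prod hK).mul_bdd (c := 1) ?_ (ae_of_all _ fun z => ?_)
    · exact Continuous.aestronglyMeasurable (by fun_prop)
    · simp
  have s2 : Integrable (fun z : (Fin d → ℝ) × (Fin d → ℝ) => h z.1 * G z.2 * chr z.2 z.1)
      (volume.prod volume) := by
    refine (hhi.mul_prod hG).mul_bdd (c := 1) ?_ (ae_of_all _ fun z => (norm_chr _ _).le)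
    exact Continuous.aestronglyMeasurable (by fun_prop)
  rw [e1, e2]
  refine (integral_integral_swap s1).trans (Eq.trans ?_ (integral_integral_swap s2).symm)
  congr 1; ext ω
  calc ∫ x, F x * K ω * conj (chr ω x) = K ω * G ω := by
        rw [← integral_const_mul]; congr 1; ext x; ring
    _ = ∫ x, h x * G ω * chr ω x := by
        rw [mul_comm, ← integral_const_mul]; congr 1; ext x; ring

/-! ### Atomic synthesis of functions in Feichtinger's algebra -/

/-- `g` is an integrable superposition of time-frequency shifts of the test function `φ`. -/
structure IsSynthesis (φ : (Fin d → ℝ) → ℂ) (c : (Fin d → ℝ) × (Fin d → ℝ) → ℂ)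
    (g : (Fin d → ℝ) → ℂ) : Prop where
  contDiff : ContDiff ℝ (⊤ : ℕ∞) φ
  hasCompactSupport : HasCompactSupport φ
  integrable : Integrable c
  eq_integral : ∀ x, g x = ∫ z, c z * tfShift z.1 z.2 φ x

theorem exists_pairing_ne_zero {g : (Fin d → ℝ) → ℂ} (hg : LocallyIntegrable g)
    (h0 : ¬ g =ᵐ[volume] 0) :
    ∃ φ : (Fin d → ℝ) → ℂ, ContDiff ℝ (⊤ : ℕ∞) φ ∧ HasCompactSupport φ ∧ pairing φ g ≠ 0 := by
  by_contra! H
  refine h0 (ae_eq_zero_of_integral_contDiff_smul_eq_zero hg fun r hr hrc => ?_)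
  have := H (fun x => (r x : ℂ)) (Complex.ofRealCLM.contDiff.comp hr)
    (hrc.comp_left Complex.ofReal_zero)
  rw [← pairing_conj, map_eq_zero] at this
  rw [← this]
  unfold pairing
  congr 1; ext x
  simp [mul_comm]

theorem stronglyMeasurable_windowedFourier {f g : (Fin d → ℝ) → ℂ} (hf : StronglyMeasurable f)
    (hg : StronglyMeasurable g) : StronglyMeasurable (windowedFourier g f) := by
  refine StronglyMeasurable.integral_prod_right
    (f := fun (z : (Fin d → ℝ) × (Fin d → ℝ)) x => f x * conj (tfShift z.1 z.2 g x)) ?_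
  have h1 : Measurable fun p : ((Fin d → ℝ) × (Fin d → ℝ)) × (Fin d → ℝ) => chr p.1.2 p.2 :=
    Continuous.measurable (by fun_prop)
  have h2 : Measurable fun p : ((Fin d → ℝ) × (Fin d → ℝ)) × (Fin d → ℝ) => g (p.2 - p.1.1) :=
    hg.measurable.comp (by fun_prop)
  have h3 : Measurable fun p : ((Fin d → ℝ) × (Fin d → ℝ)) × (Fin d → ℝ) => f p.2 :=
    hf.measurable.comp (by fun_prop)
  exact (h3.mul (Complex.continuous_conj.measurable.comp (h1.mul h2))).stronglyMeasurable

theorem memLp_transl {g : (Fin d → ℝ) → ℂ} {p : ℝ≥0∞} (hg : MemLp g p volume) (t : Fin d → ℝ) :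
    MemLp (transl t g) p volume :=
  hg.comp_measurePreserving (measurePreserving_sub_right volume t)

theorem integrable_mul_conj_transl {g : (Fin d → ℝ) → ℂ} (hg : MemLp g 2 volume)
    (t : Fin d → ℝ) : Integrable fun x => g x * conj (g (x - t)) :=
  hg.integrable_mul (memLp_transl hg t).star

/-- For fixed `t`, `ω ↦ V(t, ω)` is the Fourier transform of `x ↦ g(x) conj g(x - t)`, so inversion
recovers that product. Multiplying by `φ(x - t)` and integrating in `t` yields `g(x) ⟨φ, g⟩`; any
test function with `⟨φ, g⟩ ≠ 0` therefore synthesizes `g`, with coefficients `V / ⟨φ, g⟩`. -/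
theorem MemS0.exists_isSynthesis {g : (Fin d → ℝ) → ℂ} (hg : MemS0 g) (h0 : ¬ g =ᵐ[volume] 0) :
    ∃ φ c g', IsSynthesis φ c g' ∧ g =ᵐ[volume] g' := by
  wlog hm : StronglyMeasurable g generalizing g
  · set g₁ := hg.memLp_two.1.mk g
    have h1 : g =ᵐ[volume] g₁ := hg.memLp_two.1.ae_eq_mk
    have hw : windowedFourier g g = windowedFourier g₁ g₁ := by
      ext z; exact pairing_congr_ae h1 (tfShift_congr_ae _ _ h1)
    obtain ⟨φ, c, g', h2, h3⟩ := this ⟨(memLp_congr_ae h1).1 hg.memLp_two,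
      hw ▸ hg.integrable_windowedFourier⟩ (fun h => h0 (h1.trans h))
      hg.memLp_two.1.stronglyMeasurable_mk
    exact ⟨φ, c, g', h2, h1.trans h3⟩
  obtain ⟨φ, hφ, hφc, hne⟩ := exists_pairing_ne_zero
    (hg.memLp_two.locallyIntegrable one_le_two) h0
  set V := windowedFourier g g with hVdef
  have hV : Integrable V (volume.prod volume) := hg.integrable_windowedFourier
  have hVm : StronglyMeasurable V := stronglyMeasurable_windowedFourier hm hm
  have hVeq : ∀ t ω, V (t, ω) = ∫ x, g x * conj (g (x - t)) * conj (chr ω x) := fun t ω => by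
    rw [hVdef, windowedFourier, pairing]
    congr 1; ext x
    simp only [tfShift_apply, map_mul]; ring
  refine ⟨φ, fun z => (pairing φ g)⁻¹ * V z, _,
    ⟨hφ, hφc, hV.const_mul _, fun x => rfl⟩, ?_⟩
  have h1 : ∀ᵐ t : Fin d → ℝ, ∀ᵐ x : Fin d → ℝ,
      g x * conj (g (x - t)) = ∫ ω, V (t, ω) * chr ω x := by
    filter_upwards [hV.prod_right_ae] with t ht
    simp_rw [hVeq] at ht ⊢
    exact ae_eq_integral_fourier (integrable_mul_conj_transl hg.memLp_two t) ht
  -- Inversion holds for almost every `x` given `t`, but the integration in `t` needs it for almost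
  -- every `t` given `x`. Exchanging the quantifiers requires this set to be measurable, hence the
  -- reduction to a strongly measurable `g`.
  have hms : MeasurableSet {p : (Fin d → ℝ) × (Fin d → ℝ) |
      g p.2 * conj (g (p.2 - p.1)) = ∫ ω, V (p.1, ω) * chr ω p.2} := by
    refine measurableSet_eq_fun ?_ ?_
    · exact (hm.measurable.comp measurable_snd).mul
        (Complex.continuous_conj.measurable.comp (hm.measurable.comp (by fun_prop)))
    · refine (StronglyMeasurable.integral_prod_right (f := fun
        (p : (Fin d → ℝ) × (Fin d → ℝ)) ω => V (p.1, ω) * chr ω p.2) ?_).measurable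
      refine StronglyMeasurable.mul (hVm.comp_measurable (g := fun
        (q : ((Fin d → ℝ) × (Fin d → ℝ)) × (Fin d → ℝ)) => (q.1.1, q.2)) (by fun_prop)) ?_
      exact Continuous.stronglyMeasurable (by fun_prop)
  rw [Measure.ae_ae_comm hms] at h1
  filter_upwards [h1] with x hx
  have hbd : Integrable (fun z : (Fin d → ℝ) × (Fin d → ℝ) => V z * tfShift z.1 z.2 φ x)
      (volume.prod volume) := by
    obtain ⟨C, hC⟩ := hφ.continuous.bounded_above_of_compact_support hφc
    refine hV.mul_bdd (c := C) ?_ (ae_of_all _ fun z => ?_)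
    · have := hφ.continuous
      simp only [tfShift_apply]
      exact Continuous.aestronglyMeasurable (by fun_prop)
    · rw [tfShift_apply, norm_mul, norm_chr, one_mul]; exact hC _
  have h2 : ∫ z, V z * tfShift z.1 z.2 φ x = g x * pairing φ g := by
    rw [show (volume : Measure ((Fin d → ℝ) × (Fin d → ℝ))) = volume.prod volume from rfl,
      integral_prod _ hbd]
    have : ∀ᵐ t : Fin d → ℝ, ∫ ω, V (t, ω) * tfShift t ω φ x =
        g x * (φ (x - t) * conj (g (x - t))) := by
      filter_upwards [hx] with t ht
      rw [show g x * (φ (x - t) * conj (g (x - t))) = (g x * conj (g (x - t))) * φ (x - t) by ring,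
        ht, ← integral_mul_const]
      congr 1; ext ω
      rw [tfShift_apply]; ring
    rw [integral_congr_ae this, integral_const_mul,
      integral_sub_left_eq_self (fun y => φ y * conj (g y)) volume x]
    rfl
  simp_rw [mul_assoc]
  rw [integral_const_mul, h2]
  field_simp

theorem IsSynthesis.tfShift_bdd {φ : (Fin d → ℝ) → ℂ} (hφ : Continuous φ)
    (hc : HasCompactSupport φ) : ∃ C, ∀ t ω x, ‖tfShift t ω φ x‖ ≤ C := by
  obtain ⟨C, hC⟩ := hφ.bounded_above_of_compact_support hc
  exact ⟨C, fun t ω x => by rw [tfShift_apply, norm_mul, norm_chr, one_mul]; exact hC _⟩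

/-- Continuity of the synthesized representative is what permits pointwise Poisson summation later.
-/
theorem IsSynthesis.continuous {φ g : (Fin d → ℝ) → ℂ} {c : (Fin d → ℝ) × (Fin d → ℝ) → ℂ}
    (h : IsSynthesis φ c g) : Continuous g := by
  rw [funext h.eq_integral]
  obtain ⟨C, hC⟩ := tfShift_bdd h.contDiff.continuous h.hasCompactSupport
  have hφ := h.contDiff.continuous
  refine continuous_of_dominated (bound := fun z => ‖c z‖ * C) (fun x => ?_) (fun x => ?_)
    (h.integrable.norm.mul_const C) ?_
  · refine h.integrable.1.mul (Continuous.aestronglyMeasurable ?_)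
    simp only [tfShift_apply]; fun_prop
  · refine ae_of_all _ fun z => ?_
    rw [norm_mul]
    exact mul_le_mul_of_nonneg_left (hC _ _ _) (norm_nonneg _)
  · refine ae_of_all _ fun z => ?_
    simp only [tfShift_apply]; fun_prop

/-! ### Decay of the windowed Fourier transform of test functions -/

theorem hasLineDerivAt_conj_chr (ω x v : Fin d → ℝ) :
    HasLineDerivAt ℝ (fun x => conj (chr ω x))
      (-(2 * Real.pi * Complex.I * ((ω ⬝ᵥ v : ℝ) : ℂ)) * conj (chr ω x)) x v := by
  unfold HasLineDerivAt
  have h1 : HasDerivAt (fun t : ℝ => Complex.exp (-(2 * Real.pi * Complex.I * ((ω ⬝ᵥ v : ℝ) : ℂ)) *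
      (t : ℂ))) (Complex.exp (-(2 * Real.pi * Complex.I * ((ω ⬝ᵥ v : ℝ) : ℂ)) * ((0 : ℝ) : ℂ)) *
      (-(2 * Real.pi * Complex.I * ((ω ⬝ᵥ v : ℝ) : ℂ)) * 1)) 0 :=
    ((Complex.ofRealCLM.hasDerivAt (x := (0 : ℝ))).const_mul _).cexp
  have h2 := h1.const_mul (conj (chr ω x))
  convert! h2 using 1
  · ext t
    change conj (chr ω (x + t • v)) = _
    rw [conj_chr, conj_chr, neg_add, chr_add_right]
    congr 1
    rw [chr, dotProduct_neg, dotProduct_smul]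
    congr 1
    push_cast [smul_eq_mul]
    ring
  · simp [mul_comm]

theorem hasLineDerivAt_mul_conj_transl {φ h : (Fin d → ℝ) → ℂ} (hφ : Differentiable ℝ φ)
    (hh : Differentiable ℝ h) (t x v : Fin d → ℝ) :
    HasLineDerivAt ℝ (fun x => φ x * conj (h (x - t)))
      (fderiv ℝ φ x v * conj (h (x - t)) + φ x * conj (fderiv ℝ h (x - t) v)) x v := by
  have h1 := (hφ x).hasFDerivAt.hasLineDerivAt v
  have h2 := (hh (x - t)).hasFDerivAt.hasLineDerivAt v
  unfold HasLineDerivAt at *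
  have h3 := h1.mul h2.star
  simp only [zero_smul, add_zero] at h3
  refine h3.congr_of_eventuallyEq (Eventually.of_forall fun s => ?_)
  simp only [Pi.mul_apply, starRingEnd_apply, sub_add_eq_add_sub]

/-- Integration by parts against the character: a factor `ω·v` is traded for a derivative on `φ` or
on `h`. Iterating it gives arbitrary polynomial decay in frequency, uniformly in `t`. -/
theorem pairing_fderiv {φ h : (Fin d → ℝ) → ℂ} (hφ : ContDiff ℝ (⊤ : ℕ∞) φ)
    (hφc : HasCompactSupport φ) (hh : ContDiff ℝ (⊤ : ℕ∞) h) (t ω v : Fin d → ℝ) :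
    (2 * Real.pi * Complex.I * ((ω ⬝ᵥ v : ℝ) : ℂ)) * pairing φ (tfShift t ω h) =
      pairing (fun x => fderiv ℝ φ x v) (tfShift t ω h) +
        pairing φ (tfShift t ω fun x => fderiv ℝ h x v) := by
  have hφ' : Continuous fun x => fderiv ℝ φ x v :=
    ((hφ.fderiv_right (m := (⊤ : ℕ∞)) le_rfl).clm_apply contDiff_const).continuous
  have hh' : Continuous fun x => fderiv ℝ h x v :=
    ((hh.fderiv_right (m := (⊤ : ℕ∞)) le_rfl).clm_apply contDiff_const).continuous
  have hφ0 := hφ.continuous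
  have hh0 := hh.continuous
  have i1 : Integrable fun x => fderiv ℝ φ x v * conj (h (x - t)) * conj (chr ω x) :=
    Continuous.integrable_of_hasCompactSupport (by fun_prop)
      ((hφc.fderiv_apply ℝ v).mul_right.mul_right)
  have i2 : Integrable fun x => φ x * conj (fderiv ℝ h (x - t) v) * conj (chr ω x) :=
    Continuous.integrable_of_hasCompactSupport (by fun_prop) hφc.mul_right.mul_right
  have i3 : Integrable fun x => φ x * conj (h (x - t)) * conj (chr ω x) :=
    Continuous.integrable_of_hasCompactSupport (by fun_prop) hφc.mul_right.mul_right
  have hip := integral_bilinear_hasLineDerivAt_right_eq_neg_left_of_integrable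
    (B := ContinuousLinearMap.mul ℝ ℂ) (μ := (volume : Measure (Fin d → ℝ))) (v := v)
    (f := fun x => φ x * conj (h (x - t)))
    (f' := fun x => fderiv ℝ φ x v * conj (h (x - t)) + φ x * conj (fderiv ℝ h (x - t) v))
    (g := fun x => conj (chr ω x))
    (g' := fun x => -(2 * Real.pi * Complex.I * ((ω ⬝ᵥ v : ℝ) : ℂ)) * conj (chr ω x))
    (by simpa only [ContinuousLinearMap.mul_apply', add_mul] using! i1.add i2)
    (by
      refine (i3.const_mul (-(2 * Real.pi * Complex.I * ((ω ⬝ᵥ v : ℝ) : ℂ)))).congr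
        (ae_of_all _ fun x => ?_)
      simp only [ContinuousLinearMap.mul_apply']; ring)
    (by simpa only [ContinuousLinearMap.mul_apply'] using i3)
    (fun x _ => hasLineDerivAt_mul_conj_transl (hφ.differentiable (by simp))
      (hh.differentiable (by simp)) t x v)
    (fun x _ => hasLineDerivAt_conj_chr ω x v)
  simp only [ContinuousLinearMap.mul_apply', add_mul] at hip
  rw [integral_add i1 i2] at hip
  have e : ∀ a b : (Fin d → ℝ) → ℂ, pairing a (tfShift t ω b) =
      ∫ x, a x * conj (b (x - t)) * conj (chr ω x) := fun a b => by
    unfold pairing; congr 1; ext x; simp only [tfShift_apply, map_mul]; ring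
  rw [e, e, e, ← neg_neg (_ + _), ← hip, ← integral_neg, ← integral_const_mul]
  congr 1; ext x; ring

theorem exists_pow_mul_norm_pairing_le (N : ℕ) (i : Fin d) {φ h : (Fin d → ℝ) → ℂ}
    (hφ : ContDiff ℝ (⊤ : ℕ∞) φ) (hφc : HasCompactSupport φ) (hh : ContDiff ℝ (⊤ : ℕ∞) h)
    (hhc : HasCompactSupport h) :
    ∃ C, ∀ t ω, |ω i| ^ N * ‖pairing φ (tfShift t ω h)‖ ≤ C := by
  induction N generalizing φ h with
  | zero =>
    obtain ⟨C, hC⟩ := IsSynthesis.tfShift_bdd hh.continuous hhc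
    have hi : Integrable φ := hφ.continuous.integrable_of_hasCompactSupport hφc
    refine ⟨∫ x, ‖φ x‖ * C, fun t ω => ?_⟩
    rw [pow_zero, one_mul]
    refine norm_integral_le_of_norm_le (hi.norm.mul_const C) (ae_of_all _ fun x => ?_)
    rw [norm_mul, RCLike.norm_conj]
    exact mul_le_mul_of_nonneg_left (hC _ _ _) (norm_nonneg _)
  | succ N ih =>
    set v : Fin d → ℝ := Pi.single i 1
    obtain ⟨C₁, h₁⟩ := ih ((hφ.fderiv_right (m := (⊤ : ℕ∞)) le_rfl).clm_apply contDiff_const)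
      (hφc.fderiv_apply ℝ v) hh hhc
    obtain ⟨C₂, h₂⟩ := ih hφ hφc
      ((hh.fderiv_right (m := (⊤ : ℕ∞)) le_rfl).clm_apply contDiff_const) (hhc.fderiv_apply ℝ v)
    refine ⟨C₁ + C₂, fun t ω => ?_⟩
    have e := congr_arg norm (pairing_fderiv hφ hφc hh t ω v)
    have hv : ω ⬝ᵥ v = ω i := by simp [v]
    rw [norm_mul, hv] at e
    have h2 : ‖(2 * Real.pi * Complex.I * ((ω i : ℝ) : ℂ))‖ = 2 * Real.pi * |ω i| := by
      simp [abs_of_pos Real.pi_pos]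
    rw [h2] at e
    have h3 : |ω i| * ‖pairing φ (tfShift t ω h)‖ ≤
        ‖pairing (fun x => fderiv ℝ φ x v) (tfShift t ω h)‖ +
          ‖pairing φ (tfShift t ω fun x => fderiv ℝ h x v)‖ := by
      refine le_trans ?_ (e.le.trans (norm_add_le _ _))
      -- The factor `2π` produced by differentiation is at least one and is simply discarded.
      have : 1 ≤ 2 * Real.pi := by linarith [Real.pi_gt_three]
      have h4 : 0 ≤ |ω i| * ‖pairing φ (tfShift t ω h)‖ := by positivity
      nlinarith
    calc |ω i| ^ (N + 1) * ‖pairing φ (tfShift t ω h)‖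
        = |ω i| ^ N * (|ω i| * ‖pairing φ (tfShift t ω h)‖) := by ring
      _ ≤ |ω i| ^ N * _ := mul_le_mul_of_nonneg_left h3 (by positivity)
      _ ≤ C₁ + C₂ := by rw [mul_add]; exact add_le_add (h₁ t ω) (h₂ t ω)

/-- The polynomial weight `(1 + ‖x‖)^{-N}`. -/
noncomputable def wt {G : Type*} [NormedAddCommGroup G] (N : ℕ) (x : G) : ℝ≥0∞ :=
  ((1 + ‖x‖ₑ) ^ N)⁻¹

theorem wt_eq_ofReal {G : Type*} [NormedAddCommGroup G] (N : ℕ) (x : G) :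
    wt N x = ENNReal.ofReal (((1 + ‖x‖) ^ N)⁻¹) := by
  rw [wt, ENNReal.ofReal_inv_of_pos (by positivity), ENNReal.ofReal_pow (by positivity),
    ENNReal.ofReal_add zero_le_one (norm_nonneg _), ENNReal.ofReal_one, ofReal_norm]

theorem enorm_le_mul_wt {G : Type*} [NormedAddCommGroup G] {N : ℕ} {x : G} {F : ℂ} {C : ℝ}
    (h : (1 + ‖x‖) ^ N * ‖F‖ ≤ C) : ‖F‖ₑ ≤ ENNReal.ofReal C * wt N x := by
  rw [wt_eq_ofReal, ← ENNReal.ofReal_mul' (by positivity), ← ofReal_norm]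
  refine ENNReal.ofReal_le_ofReal ?_
  rw [← div_eq_mul_inv, le_div_iff₀ (by positivity), mul_comm]
  exact h

/-! ### Polynomial bounds for test functions and their windowed transforms. -/

theorem exists_norm_bound_of_hasCompactSupport {φ : (Fin d → ℝ) → ℂ} (hφc : HasCompactSupport φ) :
    ∃ R, 0 ≤ R ∧ ∀ x, φ x ≠ 0 → ‖x‖ ≤ R := by
  obtain ⟨R, hR⟩ := hφc.isCompact.isBounded.subset_closedBall 0
  refine ⟨max R 0, le_max_right _ _, fun x hx => le_max_of_le_left ?_⟩
  simpa using hR (subset_tsupport _ hx)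

theorem exists_enorm_le_mul_wt (N : ℕ) {φ : (Fin d → ℝ) → ℂ} (hφ : Continuous φ)
    (hφc : HasCompactSupport φ) : ∃ C : ℝ, ∀ x, ‖φ x‖ₑ ≤ ENNReal.ofReal C * wt N x := by
  obtain ⟨R, hR0, hR⟩ := exists_norm_bound_of_hasCompactSupport hφc
  obtain ⟨C, hC⟩ := hφ.bounded_above_of_compact_support hφc
  refine ⟨(1 + R) ^ N * C, fun x => enorm_le_mul_wt ?_⟩
  have hC0 : 0 ≤ C := (norm_nonneg _).trans (hC x)
  by_cases h0 : φ x = 0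
  · rw [h0, norm_zero, mul_zero]; positivity
  · have := hR x h0
    have := hC x
    gcongr

/-- Decay in `ω` comes from integration by parts; decay in `t` is free, since the supports of `φ`
and the translate of `h` are disjoint once `‖t‖ > R₁ + R₂`. -/
theorem exists_enorm_windowedFourier_le (N : ℕ) {φ h : (Fin d → ℝ) → ℂ}
    (hφ : ContDiff ℝ (⊤ : ℕ∞) φ) (hφc : HasCompactSupport φ) (hh : ContDiff ℝ (⊤ : ℕ∞) h)
    (hhc : HasCompactSupport h) :
    ∃ C : ℝ, ∀ z, ‖windowedFourier h φ z‖ₑ ≤ ENNReal.ofReal C * wt N z := by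
  obtain ⟨R₁, hR₁0, hR₁⟩ := exists_norm_bound_of_hasCompactSupport hφc
  obtain ⟨R₂, hR₂0, hR₂⟩ := exists_norm_bound_of_hasCompactSupport hhc
  have hB : ∃ C, ∀ t ω, ‖ω‖ ^ N * ‖pairing φ (tfShift t ω h)‖ ≤ C := by
    rcases isEmpty_or_nonempty (Fin d) with hd | hd
    · refine ⟨‖pairing φ (tfShift 0 0 h)‖, fun t ω => ?_⟩
      rw [Subsingleton.elim t 0, Subsingleton.elim ω 0, norm_zero]
      exact mul_le_of_le_one_left (norm_nonneg _) (pow_le_one₀ le_rfl zero_le_one)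
    -- The norm is the maximum of the coordinates, so the largest coordinate `i` of `ω` carries the
    -- decay; `j` picks the worst constant and makes the bound independent of `i`.
    · choose C hC using fun i => exists_pow_mul_norm_pairing_le N i hφ hφc hh hhc
      obtain ⟨j, hj⟩ := Finite.exists_max C
      refine ⟨C j, fun t ω => ?_⟩
      obtain ⟨i, hi⟩ := Finite.exists_max fun i => |ω i|
      have : ‖ω‖ ≤ |ω i| := (pi_norm_le_iff_of_nonneg (abs_nonneg _)).2 hi
      exact (mul_le_mul_of_nonneg_right (pow_le_pow_left₀ (norm_nonneg _) this N)
        (norm_nonneg _)).trans ((hC i t ω).trans (hj i))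
  have hB0 : ∃ C, ∀ t ω, ‖pairing φ (tfShift t ω h)‖ ≤ C := by
    rcases isEmpty_or_nonempty (Fin d) with hd | hd
    · refine ⟨‖pairing φ (tfShift 0 0 h)‖, fun t ω => ?_⟩
      rw [Subsingleton.elim t 0, Subsingleton.elim ω 0]
    · obtain ⟨C, hC⟩ := exists_pow_mul_norm_pairing_le 0 hd.some hφ hφc hh hhc
      exact ⟨C, fun t ω => by simpa using hC t ω⟩
  obtain ⟨C, hC⟩ := hB
  obtain ⟨C₀, hC₀⟩ := hB0
  -- The constant comes from `(x + y)^N ≤ 2^(N-1) (x^N + y^N)` with `x = 1 + R₁ + R₂` and `y = ‖ω‖`.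
  refine ⟨2 ^ (N - 1) * ((1 + (R₁ + R₂)) ^ N * C₀ + C), fun ⟨t, ω⟩ => enorm_le_mul_wt ?_⟩
  change (1 + ‖(t, ω)‖) ^ N * ‖pairing φ (tfShift t ω h)‖ ≤ _
  have p0 := (norm_nonneg _).trans (hC₀ 0 0)
  have p1 : 0 ≤ C := le_trans (by positivity) (hC 0 0)
  by_cases ht : ‖t‖ ≤ R₁ + R₂
  · have h1 : ‖(t, ω)‖ ≤ R₁ + R₂ + ‖ω‖ := by
      rw [Prod.norm_mk]
      exact max_le (by linarith [norm_nonneg ω]) (by linarith)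
    calc (1 + ‖(t, ω)‖) ^ N * ‖pairing φ (tfShift t ω h)‖
        ≤ ((1 + (R₁ + R₂)) + ‖ω‖) ^ N * ‖pairing φ (tfShift t ω h)‖ := by
          have : 1 + ‖(t, ω)‖ ≤ 1 + (R₁ + R₂) + ‖ω‖ := by linarith
          gcongr
      _ ≤ (2 ^ (N - 1) * ((1 + (R₁ + R₂)) ^ N + ‖ω‖ ^ N)) * ‖pairing φ (tfShift t ω h)‖ := by
          gcongr
          exact add_pow_le (by positivity) (by positivity) N
      _ = 2 ^ (N - 1) * ((1 + (R₁ + R₂)) ^ N * ‖pairing φ (tfShift t ω h)‖ +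
            ‖ω‖ ^ N * ‖pairing φ (tfShift t ω h)‖) := by ring
      _ ≤ _ := by
          gcongr
          · exact hC₀ t ω
          · exact hC t ω
  · have : pairing φ (tfShift t ω h) = 0 := by
      unfold pairing
      rw [← integral_zero (Fin d → ℝ) ℂ]
      congr 1; ext x
      by_cases h1 : φ x = 0
      · simp [h1]
      by_cases h2 : h (x - t) = 0
      · simp [tfShift_apply, h2]
      exfalso
      apply ht
      calc ‖t‖ = ‖x - (x - t)‖ := by rw [sub_sub_cancel]
        _ ≤ ‖x‖ + ‖x - t‖ := norm_sub_le _ _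
        _ ≤ _ := add_le_add (hR₁ _ h1) (hR₂ _ h2)
    rw [this, norm_zero, mul_zero]
    positivity

/-! ### Lattice sums of polynomial weights -/

section Weight

variable {G : Type*} [NormedAddCommGroup G]

theorem wt_neg (N : ℕ) (x : G) : wt N (-x) = wt N x := by simp [wt]

theorem wt_le_one (N : ℕ) (x : G) : wt N x ≤ 1 := by
  rw [wt, ENNReal.inv_le_one]
  exact one_le_pow₀ le_self_add

theorem measurable_wt [MeasurableSpace G] [OpensMeasurableSpace G] (N : ℕ) :
    Measurable (wt N : G → ℝ≥0∞) := by
  unfold wt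
  exact ((measurable_const.add measurable_enorm).pow_const N).inv

theorem _root_.Measurable.wt [MeasurableSpace G] [OpensMeasurableSpace G] {N : ℕ} {X : Type*}
    [MeasurableSpace X] {f : X → G} (hf : Measurable f) : Measurable fun x => wt N (f x) :=
  (measurable_wt N).comp hf

theorem wt_le_of_le {G' : Type*} [NormedAddCommGroup G'] {N : ℕ} {m : ℝ} (hm : 0 < m) {x : G}
    {y : G'} (h : m * (1 + ‖y‖) ≤ 1 + ‖x‖) :
    wt N x ≤ ENNReal.ofReal ((m ^ N)⁻¹) * wt N y := by
  rw [wt_eq_ofReal, wt_eq_ofReal, ← ENNReal.ofReal_mul (by positivity)]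
  refine ENNReal.ofReal_le_ofReal ?_
  rw [← mul_inv, ← mul_pow]
  gcongr

/-- Peetre's inequality. -/
theorem wt_sub_le (N : ℕ) (x y : G) : wt N (x - y) ≤ ENNReal.ofReal ((1 + ‖y‖) ^ N) * wt N x := by
  have := wt_le_of_le (N := N) (m := (1 + ‖y‖)⁻¹) (by positivity) (x := x - y) (y := x) (by
    rw [inv_mul_le_iff₀ (by positivity)]
    have := norm_le_norm_add_norm_sub' x y
    have h1 := norm_nonneg y
    have h2 := norm_nonneg (x - y)
    nlinarith)
  simpa using! this

end Weight

theorem nnnorm_intCast_real (n : ℤ) : ‖(n : ℝ)‖₊ = ‖n‖₊ := NNReal.eq (Int.norm_cast_real n)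

theorem tsum_wt_pi_ne_top {ι : Type*} [Fintype ι] {N : ℕ} (hN : Fintype.card ι < N) :
    ∑' k : ι → ℤ, wt N k ≠ ∞ := by
  set L := Submodule.span ℤ (Set.range (Pi.basisFun ℝ ι))
  have hr : Module.finrank ℤ L = Fintype.card ι := by
    rw [ZLattice.rank ℝ L, Module.finrank_fintype_fun_eq_card]
  have hs := ZLattice.summable_norm_pow_inv L N (hr ▸ hN)
  let f : (ι → ℤ) → L := fun k => ⟨fun i => (k i : ℝ), by
    rw [Module.Basis.mem_span_iff_repr_mem]
    intro i
    exact ⟨k i, by simp⟩⟩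
  have hf : Function.Injective f := fun k k' h => by
    ext i
    have := congr_fun (congr_arg Subtype.val h) i
    exact Int.cast_injective (α := ℝ) this
  have hs' := hs.comp_injective hf
  have hn : ∀ k, ‖f k‖ = ‖k‖ := fun k => by
    change ‖fun i => (k i : ℝ)‖ = _
    simp [Pi.norm_def, nnnorm_intCast_real]
  have h1 : Summable fun k : ι → ℤ => ((1 + ‖k‖) ^ N)⁻¹ := by
    -- The origin is removed because there the comparison term `‖k‖⁻¹ ^ N` takes the value `0`,
    -- while the weight is `1`.
    rw [← Finset.summable_compl_iff ({0} : Finset (ι → ℤ))]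
    refine Summable.of_nonneg_of_le (fun k => by positivity) (fun k => ?_)
      (hs'.comp_injective Subtype.val_injective)
    simp only [Function.comp_apply, hn]
    have hk : (k : ι → ℤ) ≠ 0 := by simpa using k.2
    have : 0 < ‖(k : ι → ℤ)‖ := norm_pos_iff.2 hk
    rw [inv_pow]
    gcongr
    linarith
  simp_rw [wt_eq_ofReal]
  exact h1.tsum_ofReal_ne_top

theorem tsum_wt_prod_ne_top {N : ℕ} (hN : 2 * d < N) :
    ∑' k : (Fin d → ℤ) × (Fin d → ℤ), wt N k ≠ ∞ := by
  have h := tsum_wt_pi_ne_top (ι := Fin d ⊕ Fin d) (N := N) (by simp; omega)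
  rw [← (Equiv.sumArrowEquivProdArrow (Fin d) (Fin d) ℤ).tsum_eq]
  refine ne_top_of_le_ne_top h (ENNReal.tsum_le_tsum fun k => ?_)
  have := wt_le_of_le (N := N) (m := 1) one_pos (y := k)
    (x := Equiv.sumArrowEquivProdArrow (Fin d) (Fin d) ℤ k) ?_
  · simpa using this
  · rw [one_mul]
    refine add_le_add le_rfl ?_
    rw [pi_norm_le_iff_of_nonneg (norm_nonneg _)]
    rintro (i | i)
    · exact (norm_le_pi_norm (fun i => k (Sum.inl i)) i).trans 
        (norm_fst_le (Equiv.sumArrowEquivProdArrow (Fin d) (Fin d) ℤ k))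
    · exact (norm_le_pi_norm (fun i => k (Sum.inr i)) i).trans
        (norm_snd_le (Equiv.sumArrowEquivProdArrow (Fin d) (Fin d) ℤ k))

section Lattice

variable {K G : Type*} [NormedAddCommGroup K] [NormedAddCommGroup G]

/-- An additive map that expands norms by the factor `s` and whose image contains a best
approximation of every point. -/
structure IsLatticeMap (s : ℝ) (T : K → G) : Prop where
  map_sub : ∀ k k', T (k - k') = T k - T k'
  le_norm : ∀ k, s * ‖k‖ ≤ ‖T k‖
  exists_near : ∀ u, ∃ k₀, ∀ k, ‖u - T k₀‖ ≤ ‖u - T k‖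

/-- If `T k₀` is a lattice point nearest to `u`, then `s‖k - k₀‖ ≤ ‖T k - T k₀‖ ≤ 2‖u - T k‖`. After
recentring at `k₀` the bound no longer depends on `u`. -/
theorem IsLatticeMap.tsum_wt_le {s : ℝ} (hs : 0 < s) {T : K → G} (hT : IsLatticeMap s T) (N : ℕ)
    (u : G) :
    ∑' k, wt N (u - T k) ≤ ENNReal.ofReal (((min 1 (s / 2)) ^ N)⁻¹) * ∑' k : K, wt N k := by
  obtain ⟨k₀, hk₀⟩ := hT.exists_near u
  rw [← (Equiv.subRight k₀).tsum_eq (fun k => wt N k), ← ENNReal.tsum_mul_left]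
  refine ENNReal.tsum_le_tsum fun k => wt_le_of_le (by positivity) ?_
  have h1 : s * ‖k - k₀‖ ≤ 2 * ‖u - T k‖ := by
    calc s * ‖k - k₀‖ ≤ ‖T (k - k₀)‖ := hT.le_norm _
      _ = ‖(u - T k₀) - (u - T k)‖ := by rw [hT.map_sub]; congr 1; abel
      _ ≤ ‖u - T k₀‖ + ‖u - T k‖ := norm_sub_le _ _
      _ ≤ _ := by linarith [hk₀ k]
  have h2 : min 1 (s / 2) ≤ 1 := min_le_left _ _
  have h3 : min 1 (s / 2) * ‖k - k₀‖ ≤ s / 2 * ‖k - k₀‖ :=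
    mul_le_mul_of_nonneg_right (min_le_right _ _) (norm_nonneg _)
  change min 1 (s / 2) * (1 + ‖k - k₀‖) ≤ 1 + ‖u - T k‖
  linarith

/-- For `‖k‖ ≥ 1` and `‖u‖ ≤ s/2` one has `‖u - T k‖ ≥ s‖k‖ - s/2 ≥ (s/4)(1 + ‖k‖)`. Dropping the
origin thus gains a factor `s^{-N}`, which vanishes as the lattice spreads out. -/
theorem IsLatticeMap.tsum_wt_ne_zero_le {s : ℝ} (hs : 0 < s) {T : K → G} (hT : IsLatticeMap s T)
    (N : ℕ) (u : G) (hu : 2 * ‖u‖ ≤ s) (h1 : ∀ k : K, k ≠ 0 → 1 ≤ ‖k‖) :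
    ∑' k : {k : K // k ≠ 0}, wt N (u - T k) ≤
      ENNReal.ofReal (((s / 4) ^ N)⁻¹) * ∑' k : K, wt N k := by
  refine le_trans ?_ (mul_le_mul_right (ENNReal.tsum_comp_le_tsum_of_injective
    (Subtype.val_injective (p := fun k : K => k ≠ 0)) (fun k : K => wt N k)) _)
  rw [← ENNReal.tsum_mul_left]
  refine ENNReal.tsum_le_tsum fun k => wt_le_of_le (by positivity) ?_
  have h2 := hT.le_norm k
  have h3 := h1 k k.2
  have h4 : ‖T k‖ - ‖u‖ ≤ ‖u - T k‖ := by
    rw [norm_sub_rev]; exact norm_sub_norm_le _ _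
  nlinarith

end Lattice

theorem norm_latticePt {c : ℝ} (hc : 0 < c) (k : Fin d → ℤ) : ‖latticePt c k‖ = c * ‖k‖ := by
  have : latticePt c k = c • fun i => (k i : ℝ) := rfl
  rw [this, norm_smul, Real.norm_of_nonneg hc.le]
  simp [Pi.norm_def, nnnorm_intCast_real]

theorem latticePt_sub (c : ℝ) (k k' : Fin d → ℤ) :
    latticePt c (k - k') = latticePt c k - latticePt c k' := by
  ext i; simp [latticePt, mul_sub]

@[simp] theorem latticePt_zero (c : ℝ) : latticePt c (0 : Fin d → ℤ) = 0 := by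
  ext i; simp [latticePt]

theorem latticePt_neg (c : ℝ) (k : Fin d → ℤ) : latticePt c (-k) = -latticePt c k := by
  ext i; simp [latticePt]

theorem isLatticeMap_latticePt {c : ℝ} (hc : 0 < c) :
    IsLatticeMap c (latticePt c : (Fin d → ℤ) → Fin d → ℝ) where
  map_sub := latticePt_sub c
  le_norm k := (norm_latticePt hc k).ge
  exists_near u := by
    refine ⟨fun i => round (u i / c), fun k => ?_⟩
    rw [pi_norm_le_iff_of_nonneg (norm_nonneg _)]
    intro i
    refine le_trans ?_ (norm_le_pi_norm _ i)
    have h : ∀ z : ℤ, u i - c * z = c * (u i / c - z) := fun z => by field_simp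
    simp only [Pi.sub_apply, latticePt, h, Real.norm_eq_abs, abs_mul]
    exact mul_le_mul_of_nonneg_left (round_le _ _) (abs_nonneg _)

/-- The point `(c k, c' k')` of the lattice `c ℤ^d × c' ℤ^d`. -/
noncomputable def tfLattice (c c' : ℝ) (k : (Fin d → ℤ) × (Fin d → ℤ)) :
    (Fin d → ℝ) × (Fin d → ℝ) :=
  (latticePt c k.1, latticePt c' k.2)

theorem isLatticeMap_tfLattice {c c' : ℝ} (hc : 0 < c) (hc' : 0 < c') :
    IsLatticeMap (min c c') (tfLattice c c' : (Fin d → ℤ) × (Fin d → ℤ) → _) where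
  map_sub k k' := by simp [tfLattice, latticePt_sub]
  le_norm k := by
    rw [tfLattice, Prod.norm_mk (latticePt c k.1), norm_latticePt hc, norm_latticePt hc',
      Prod.norm_def, mul_max_of_nonneg _ _ (by positivity)]
    exact max_le_max (mul_le_mul_of_nonneg_right (min_le_left _ _) (norm_nonneg _))
      (mul_le_mul_of_nonneg_right (min_le_right _ _) (norm_nonneg _))
  exists_near u := by
    obtain ⟨k₁, h₁⟩ := (isLatticeMap_latticePt hc).exists_near u.1
    obtain ⟨k₂, h₂⟩ := (isLatticeMap_latticePt hc').exists_near u.2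
    exact ⟨(k₁, k₂), fun k => max_le_max (h₁ _) (h₂ _)⟩

theorem one_le_norm_of_ne_zero (k : (Fin d → ℤ) × (Fin d → ℤ)) (hk : k ≠ 0) : 1 ≤ ‖k‖ := by
  have key : ∀ l : Fin d → ℤ, l ≠ 0 → 1 ≤ ‖l‖ := fun l hl => by
    obtain ⟨i, hi⟩ := Function.ne_iff.1 hl
    refine le_trans ?_ (norm_le_pi_norm l i)
    rw [Int.norm_eq_abs]
    exact_mod_cast Int.one_le_abs hi
  by_cases h : k.1 = 0
  · have : k.2 ≠ 0 := fun h2 => hk (Prod.ext h h2)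
    exact (key _ this).trans (norm_snd_le k)
  · exact (key _ h).trans (norm_fst_le k)

/-! ### Functions dominated by a smeared polynomial weight -/

/-- `F` is dominated by the convolution of a finite measure with a polynomial weight. -/
def HasDecay {G : Type*} [NormedAddCommGroup G] [MeasurableSpace G] (N : ℕ) (F : G → ℂ) : Prop :=
  ∃ ν : Measure G, IsFiniteMeasure ν ∧ ∀ z, ‖F z‖ₑ ≤ ∫⁻ u, wt N (z - u) ∂ν

theorem HasDecay.exists_bound {G : Type*} [NormedAddCommGroup G] [MeasurableSpace G] {N : ℕ} {F : G → ℂ} (hF : HasDecay N F) : ∃ C, ∀ z, ‖F z‖ ≤ C := by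
  obtain ⟨ν, hν, h⟩ := hF
  refine ⟨(ν Set.univ).toReal, fun z => ?_⟩
  rw [← toReal_enorm]
  refine ENNReal.toReal_mono (measure_ne_top ν _) ((h z).trans ?_)
  refine (lintegral_mono fun u => wt_le_one N _).trans ?_
  simp

section Decay

variable {K G : Type*} [NormedAddCommGroup K] [Countable K] [NormedAddCommGroup G]
  [MeasurableSpace G] [BorelSpace G]

theorem tsum_lintegral_wt_le {s : ℝ} (hs : 0 < s) {T : K → G}
    (hT : IsLatticeMap s T) (N : ℕ) (ν : Measure G) (z : G) :
    ∑' k, ∫⁻ u, wt N (z + T k - u) ∂ν ≤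
      ENNReal.ofReal (((min 1 (s / 2)) ^ N)⁻¹) * (∑' k : K, wt N k) * ν Set.univ := by
  rw [← lintegral_tsum fun k => (Measurable.wt (by fun_prop)).aemeasurable,
    ← lintegral_const]
  refine lintegral_mono fun u => ?_
  have : ∀ k, wt N (z + T k - u) = wt N ((u - z) - T k) := fun k => by
    rw [← wt_neg]; congr 1; abel
  simp_rw [this]
  exact hT.tsum_wt_le hs N _

theorem HasDecay.exists_tsum_le {N : ℕ} (hN : ∑' k : K, wt N k ≠ ∞) {s : ℝ} (hs : 0 < s)
    {T : K → G} (hT : IsLatticeMap s T) {F : G → ℂ} (hF : HasDecay N F) :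
    ∃ C : ℝ≥0∞, C ≠ ∞ ∧ ∀ z, ∑' k, ‖F (z + T k)‖ₑ ≤ C := by
  obtain ⟨ν, hν, h⟩ := hF
  exact ⟨_, ENNReal.mul_ne_top (ENNReal.mul_ne_top ENNReal.ofReal_ne_top hN)
    (measure_ne_top ν _), fun z => (ENNReal.tsum_le_tsum fun k => h _).trans
    (tsum_lintegral_wt_le hs hT N ν z)⟩

theorem HasDecay.tsum_ne_top {N : ℕ} (hN : ∑' k : K, wt N k ≠ ∞) {s : ℝ}
    (hs : 0 < s) {T : K → G} (hT : IsLatticeMap s T) {F : G → ℂ} (hF : HasDecay N F) :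
    ∑' k, ‖F (T k)‖ₑ ≠ ∞ := by
  obtain ⟨C, hC, h⟩ := hF.exists_tsum_le hN hs hT
  have := h 0
  simp only [zero_add] at this
  exact ne_top_of_le_ne_top hC this

end Decay

/-- Dominated convergence in the smearing variable `u`. For fixed `u` the sum is eventually in the
range of `tsum_wt_ne_zero_le` and tends to zero; the bound uniform in `u` from `tsum_wt_le` is
integrable because `ν` is finite. -/
theorem HasDecay.tendsto_tsum_ne_zero {N : ℕ} (hN : 2 * d < N)
    {F : (Fin d → ℝ) × (Fin d → ℝ) → ℂ} (hF : HasDecay N F) :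
    Tendsto (fun ab : ℝ × ℝ => ∑' k : {k : (Fin d → ℤ) × (Fin d → ℤ) // k ≠ 0},
      ‖F (tfLattice (1 / ab.2) (1 / ab.1) k)‖ₑ) (𝓝[>] 0 ×ˢ 𝓝[>] 0) (𝓝 0) := by
  obtain ⟨ν, hν, h⟩ := hF
  have hN0 : N ≠ 0 := by omega
  set W : ℝ≥0∞ := ∑' k : (Fin d → ℤ) × (Fin d → ℤ), wt N k
  have hW : W ≠ ∞ := tsum_wt_prod_ne_top hN
  set Φ : ℝ × ℝ → (Fin d → ℝ) × (Fin d → ℝ) → ℝ≥0∞ := fun ab u =>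
    ∑' k : {k : (Fin d → ℤ) × (Fin d → ℤ) // k ≠ 0}, wt N (u - tfLattice (1 / ab.2) (1 / ab.1) k)
  have hmΦ : ∀ ab, Measurable (Φ ab) := fun ab =>
    Measurable.tsum fun k => Measurable.wt (by fun_prop)
  have hs : Tendsto (fun ab : ℝ × ℝ => min (1 / ab.2) (1 / ab.1)) (𝓝[>] 0 ×ˢ 𝓝[>] 0) atTop := by
    simp only [one_div]
    have h1 := tendsto_inv_nhdsGT_zero.comp (tendsto_fst (f := 𝓝[>] (0 : ℝ)) (g := 𝓝[>] (0 : ℝ)))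
    have h2 := tendsto_inv_nhdsGT_zero.comp (tendsto_snd (f := 𝓝[>] (0 : ℝ)) (g := 𝓝[>] (0 : ℝ)))
    refine tendsto_atTop.2 fun B => ?_
    filter_upwards [h1.eventually_ge_atTop B, h2.eventually_ge_atTop B] with ab k1 k2
    exact le_min k2 k1
  have hpos : ∀ᶠ ab : ℝ × ℝ in 𝓝[>] 0 ×ˢ 𝓝[>] 0, 0 < ab.1 ∧ 0 < ab.2 :=
    prod_mem_prod self_mem_nhdsWithin self_mem_nhdsWithin
  have hle : ∀ ab, ∑' k : {k : (Fin d → ℤ) × (Fin d → ℤ) // k ≠ 0},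
      ‖F (tfLattice (1 / ab.2) (1 / ab.1) k)‖ₑ ≤ ∫⁻ u, Φ ab u ∂ν := fun ab => by
    simp only [Φ]
    rw [lintegral_tsum fun k => (Measurable.wt (by fun_prop)).aemeasurable]
    refine ENNReal.tsum_le_tsum fun k => (h _).trans (le_of_eq ?_)
    congr 1; ext u
    rw [← wt_neg, neg_sub]
  refine tendsto_of_tendsto_of_tendsto_of_le_of_le tendsto_const_nhds ?_ (fun _ => zero_le) hle
  rw [← lintegral_zero (μ := ν)]
  refine tendsto_lintegral_filter_of_dominated_convergence
    -- This is the constant of `tsum_wt_le` at expansion factor `1`, which majorizes it for all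
    -- larger factors.
    (fun _ => ENNReal.ofReal (((min 1 (1 / 2 : ℝ)) ^ N)⁻¹) * W) (Eventually.of_forall hmΦ) ?_ ?_ ?_
  · filter_upwards [hpos, hs.eventually_ge_atTop 1] with ab h0 h1
    refine ae_of_all _ fun u => ?_
    have hT := isLatticeMap_tfLattice (d := d) (c := 1 / ab.2) (c' := 1 / ab.1)
      (by have := h0.2; positivity) (by have := h0.1; positivity)
    refine (ENNReal.tsum_comp_le_tsum_of_injective (Subtype.val_injective
      (p := fun k : (Fin d → ℤ) × (Fin d → ℤ) => k ≠ 0)) (fun k => wt N (u - tfLattice (1 / ab.2)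
      (1 / ab.1) k))).trans ((hT.tsum_wt_le (zero_lt_one.trans_le h1) N u).trans ?_)
    refine mul_le_mul_left (ENNReal.ofReal_le_ofReal ?_) _
    gcongr
  · rw [lintegral_const]
    exact ENNReal.mul_ne_top (ENNReal.mul_ne_top ENNReal.ofReal_ne_top hW) (measure_ne_top ν _)
  · refine ae_of_all _ fun u => ?_
    have hlim : Tendsto (fun ab : ℝ × ℝ =>
        ENNReal.ofReal (((min (1 / ab.2) (1 / ab.1) / 4) ^ N)⁻¹) * W) (𝓝[>] 0 ×ˢ 𝓝[>] 0) (𝓝 0) := by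
      rw [← zero_mul W, ← ENNReal.ofReal_zero]
      refine ENNReal.Tendsto.mul_const (ENNReal.tendsto_ofReal ?_) (Or.inr hW)
      exact tendsto_inv_atTop_zero.comp ((tendsto_pow_atTop hN0).comp
        (hs.atTop_div_const (by norm_num)))
    refine tendsto_of_tendsto_of_tendsto_of_le_of_le' tendsto_const_nhds hlim
      (Eventually.of_forall fun _ => zero_le) ?_
    filter_upwards [hpos, hs.eventually_ge_atTop 1, hs.eventually_ge_atTop (2 * ‖u‖)]
      with ab h0 h1 h2
    have hT := isLatticeMap_tfLattice (d := d) (c := 1 / ab.2) (c' := 1 / ab.1)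
      (by have := h0.2; positivity) (by have := h0.1; positivity)
    exact hT.tsum_wt_ne_zero_le (zero_lt_one.trans_le h1) N u h2 one_le_norm_of_ne_zero

/-! ### Decay of synthesized functions and of their windowed Fourier transforms -/

theorem isFiniteMeasure_withDensity_enorm {X : Type*} [MeasurableSpace X] {μ : Measure X}
    {c : X → ℂ} (hc : Integrable c μ) : IsFiniteMeasure (μ.withDensity fun z => ‖c z‖ₑ) :=
  isFiniteMeasure_withDensity hc.2.ne

/-- A bound averaged over an arbitrary parameter space becomes a smeared weight by pushing the
parameter measure forward along `π`; the constant is absorbed into the measure. -/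
theorem HasDecay.of_le_lintegral {X G : Type*} [MeasurableSpace X] [NormedAddCommGroup G]
    [MeasurableSpace G] [BorelSpace G] {N : ℕ} {F : G → ℂ} {μ : Measure X} [IsFiniteMeasure μ]
    {π : X → G} (hπ : Measurable π) {C : ℝ}
    (h : ∀ z, ‖F z‖ₑ ≤ ∫⁻ x, ENNReal.ofReal C * wt N (z - π x) ∂μ) : HasDecay N F := by
  refine ⟨ENNReal.ofReal C • μ.map π, ?_, fun z => (h z).trans ?_⟩
  · exact Measure.smul_finite _ ENNReal.ofReal_ne_top
  · rw [lintegral_smul_measure, lintegral_const_mul' _ _ ENNReal.ofReal_ne_top,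
      lintegral_map (f := fun u => wt N (z - u)) (Measurable.wt (by fun_prop)) hπ]
    rfl

/-- Modulations do not change absolute values, so only the marginal of `|c|` in the translation
variable matters. -/
theorem IsSynthesis.hasDecay {φ g : (Fin d → ℝ) → ℂ} {c : (Fin d → ℝ) × (Fin d → ℝ) → ℂ}
    (h : IsSynthesis φ c g) (N : ℕ) : HasDecay N g := by
  obtain ⟨C, hC⟩ := exists_enorm_le_mul_wt N h.contDiff.continuous h.hasCompactSupport
  have := isFiniteMeasure_withDensity_enorm h.integrable
  refine HasDecay.of_le_lintegral (μ := volume.withDensity fun z => ‖c z‖ₑ) (π := Prod.fst)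
    (C := C) measurable_fst fun x => ?_
  rw [lintegral_withDensity_eq_lintegral_mul₀ h.integrable.1.enorm
    ((Measurable.wt (by fun_prop)).const_mul _).aemeasurable, h.eq_integral]
  refine (enorm_integral_le_lintegral_enorm _).trans (lintegral_mono fun z => ?_)
  rw [enorm_mul, tfShift_apply, enorm_mul, enorm_chr, one_mul]
  exact mul_le_mul_right (hC _) _

theorem IsSynthesis.integrable_prod {φ g : (Fin d → ℝ) → ℂ}
    {c : (Fin d → ℝ) × (Fin d → ℝ) → ℂ} (h : IsSynthesis φ c g) :
    Integrable (fun p : ((Fin d → ℝ) × (Fin d → ℝ)) × (Fin d → ℝ) =>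
      c p.1 * φ (p.2 - p.1.1)) (volume.prod volume) := by
  have hφ := h.contDiff.continuous
  have hφi : Integrable φ := hφ.integrable_of_hasCompactSupport h.hasCompactSupport
  have hm : AEStronglyMeasurable (fun p : ((Fin d → ℝ) × (Fin d → ℝ)) × (Fin d → ℝ) =>
      c p.1 * φ (p.2 - p.1.1)) (volume.prod volume) :=
    h.integrable.1.comp_fst.mul (Continuous.aestronglyMeasurable (by fun_prop))
  rw [integrable_prod_iff hm]
  refine ⟨ae_of_all _ fun z => (hφi.comp_sub_right z.1).const_mul (c z), ?_⟩
  refine (h.integrable.norm.mul_const (∫ x, ‖φ x‖)).congr (ae_of_all _ fun z => ?_)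
  simp only [norm_mul]
  rw [integral_const_mul, integral_sub_right_eq_self (fun y => ‖φ y‖) z.1]

theorem IsSynthesis.enorm_pairing_le {φ g F : (Fin d → ℝ) → ℂ}
    {c : (Fin d → ℝ) × (Fin d → ℝ) → ℂ} (h : IsSynthesis φ c g)
    (hF : AEStronglyMeasurable F volume) {C : ℝ} (hC : ∀ x, ‖F x‖ ≤ C) :
    ‖pairing F g‖ₑ ≤ ∫⁻ z, ‖c z‖ₑ * ‖pairing F (tfShift z.1 z.2 φ)‖ₑ := by
  have hi : Integrable (fun p : ((Fin d → ℝ) × (Fin d → ℝ)) × (Fin d → ℝ) =>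
      conj (c p.1 * φ (p.2 - p.1.1)) * (F p.2 * conj (chr p.1.2 p.2))) (volume.prod volume) := by
    refine Integrable.mul_bdd (c := C)
      (memLp_one_iff_integrable.1 (memLp_one_iff_integrable.2 h.integrable_prod).star) ?_ (ae_of_all _ fun p => ?_)
    · exact hF.comp_snd.mul (Continuous.aestronglyMeasurable (by fun_prop))
    · rw [norm_mul, RCLike.norm_conj, norm_chr, mul_one]; exact hC _
  have e1 : pairing F g = ∫ x, ∫ z : (Fin d → ℝ) × (Fin d → ℝ),
      conj (c z * φ (x - z.1)) * (F x * conj (chr z.2 x)) := by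
    unfold pairing
    congr 1; ext x
    rw [h.eq_integral, ← integral_conj, ← integral_const_mul]
    congr 1; ext z
    simp only [tfShift_apply, map_mul]; ring
  have e2 : ∀ z : (Fin d → ℝ) × (Fin d → ℝ),
      ∫ x, conj (c z * φ (x - z.1)) * (F x * conj (chr z.2 x)) =
        conj (c z) * pairing F (tfShift z.1 z.2 φ) := fun z => by
    unfold pairing
    rw [← integral_const_mul]
    congr 1; ext x
    simp only [tfShift_apply, map_mul]; ring
  rw [e1, ← integral_integral_swap hi]
  simp_rw [e2]
  refine (enorm_integral_le_lintegral_enorm _).trans (lintegral_mono fun z => ?_)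
  rw [enorm_mul, RCLike.enorm_conj]

theorem continuous_tfShift {h : (Fin d → ℝ) → ℂ} (hh : Continuous h) (t ω : Fin d → ℝ) :
    Continuous (tfShift t ω h) := by
  have : tfShift t ω h = fun x => chr ω x * h (x - t) := rfl
  rw [this]; fun_prop

theorem IsSynthesis.hasDecay_windowedFourier_test {φ γ h : (Fin d → ℝ) → ℂ}
    {c : (Fin d → ℝ) × (Fin d → ℝ) → ℂ} (hγ : IsSynthesis φ c γ)
    (hh : ContDiff ℝ (⊤ : ℕ∞) h) (hhc : HasCompactSupport h) (N : ℕ) :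
    HasDecay N (windowedFourier h γ) := by
  obtain ⟨C, hC⟩ := exists_enorm_windowedFourier_le N hh hhc hγ.contDiff hγ.hasCompactSupport
  have := isFiniteMeasure_withDensity_enorm hγ.integrable
  obtain ⟨B, hB⟩ := IsSynthesis.tfShift_bdd hh.continuous hhc
  refine HasDecay.of_le_lintegral (μ := volume.withDensity fun z => ‖c z‖ₑ) (π := id)
    (C := C) measurable_id fun z => ?_
  rw [lintegral_withDensity_eq_lintegral_mul₀ hγ.integrable.1.enorm
    ((Measurable.wt (by fun_prop)).const_mul _).aemeasurable, windowedFourier, norm_pairing_comm]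
  refine (hγ.enorm_pairing_le (continuous_tfShift hh.continuous _ _).aestronglyMeasurable
    (hB z.1 z.2)).trans (lintegral_mono fun w => mul_le_mul_right ?_ _)
  rw [enorm_pairing_tfShift_tfShift]
  change _ ≤ ENNReal.ofReal C * wt N (z - w)
  rw [← wt_neg, neg_sub]
  exact hC (w - z)

/-- Expanding `g` in shifts of `ψ` bounds the value at `z` by an average of `|⟨γ, τ(w + z)ψ⟩|` with
weight `|e(w)|`. The latter is smeared by `ν`, so the final measure is the image of `|e| ⊗ ν` under
`(w, u) ↦ u - w`. -/
theorem IsSynthesis.hasDecay_windowedFourier {φ γ ψ g : (Fin d → ℝ) → ℂ}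
    {c e : (Fin d → ℝ) × (Fin d → ℝ) → ℂ} (hγ : IsSynthesis φ c γ) (hg : IsSynthesis ψ e g)
    (N : ℕ) : HasDecay N (windowedFourier g γ) := by
  obtain ⟨ν, hν, hνle⟩ :=
    hγ.hasDecay_windowedFourier_test hg.contDiff hg.hasCompactSupport N
  have := isFiniteMeasure_withDensity_enorm hg.integrable
  obtain ⟨B, hB⟩ := (hγ.hasDecay 0).exists_bound
  refine HasDecay.of_le_lintegral (μ := (volume.withDensity fun z => ‖e z‖ₑ).prod ν)
    (π := fun p => p.2 - p.1) (C := 1) (by fun_prop) fun z => ?_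
  simp only [ENNReal.ofReal_one, one_mul]
  rw [lintegral_prod _ (Measurable.wt (by fun_prop)).aemeasurable,
    lintegral_withDensity_eq_lintegral_mul₀ hg.integrable.1.enorm
      (Measurable.lintegral_prod_right' (f := fun p : ((Fin d → ℝ) × (Fin d → ℝ)) ×
        ((Fin d → ℝ) × (Fin d → ℝ)) => wt N (z - (p.2 - p.1)))
        (Measurable.wt (by fun_prop))).aemeasurable,
    windowedFourier, enorm_pairing_tfShift_right]
  refine (hg.enorm_pairing_le (C := B)
    (continuous_tfShift hγ.continuous _ _).aestronglyMeasurable fun x => ?_).trans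
    (lintegral_mono fun w => mul_le_mul_right ?_ _)
  · rw [tfShift_apply, norm_mul, norm_chr, one_mul]; exact hB _
  · rw [enorm_pairing_tfShift_tfShift]
    have := hνle (w + z)
    rw [windowedFourier] at this
    simp only [sub_neg_eq_add]
    refine this.trans (le_of_eq ?_)
    congr 1; ext u; congr 1; abel

/-! ### Integrals against locally integrable functions of uniformly bounded local mass -/

theorem pairwise_disjoint_cube : Pairwise (Function.onFun Disjoint (cube (d := d))) := by
  intro k k' hne
  rw [Function.onFun, Set.disjoint_left]
  intro x hx hx'
  apply hne
  ext i
  have h1 := hx i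
  have h2 := hx' i
  have h3 : (k i : ℝ) < k' i + 1 := by linarith
  have h4 : (k' i : ℝ) < k i + 1 := by linarith
  norm_cast at h3 h4
  omega

theorem iUnion_cube : ⋃ k, cube (d := d) k = Set.univ :=
  Set.eq_univ_of_forall fun x => Set.mem_iUnion.2 ⟨_, mem_cube_floor x⟩

theorem lintegral_eq_tsum_cube (F : (Fin d → ℝ) → ℝ≥0∞) :
    ∫⁻ x, F x = ∑' k, ∫⁻ x in cube k, F x := by
  rw [← lintegral_iUnion measurableSet_cube pairwise_disjoint_cube, iUnion_cube,
    Measure.restrict_univ]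

theorem setLIntegral_cube_le (f : (Fin d → ℝ) → ℂ) (k : Fin d → ℤ) :
    ∫⁻ x in cube k, ‖f x‖ₑ ≤ amalgamENorm 1 ∞ f := by
  rw [amalgamENorm_top]
  refine le_trans (le_of_eq ?_) (le_iSup _ k)
  rw [eLpNorm_one_eq_lintegral_enorm, ← lintegral_indicator (measurableSet_cube k)]
  congr 1; ext x
  rw [enorm_indicator_eq_indicator_enorm]

/-- On a unit cube the weight is comparable, by Peetre's inequality, to its value at the corner,
with factor `2^N`. What remains is a lattice sum of weights, bounded uniformly in `t`. -/
theorem exists_lintegral_mul_wt_le {N : ℕ} (hN : d < N) :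
    ∃ C : ℝ≥0∞, C ≠ ∞ ∧ ∀ (f : (Fin d → ℝ) → ℂ) (t : Fin d → ℝ),
      ∫⁻ x, ‖f x‖ₑ * wt N (x - t) ≤ C * amalgamENorm 1 ∞ f := by
  set W : ℝ≥0∞ := ∑' k : Fin d → ℤ, wt N k
  have hW : W ≠ ∞ := tsum_wt_pi_ne_top (by simpa using hN)
  set c₁ : ℝ≥0∞ := ENNReal.ofReal ((1 + 1) ^ N)
  set c₂ : ℝ≥0∞ := ENNReal.ofReal (((min 1 (1 / 2 : ℝ)) ^ N)⁻¹) * W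
  refine ⟨c₁ * c₂, ENNReal.mul_ne_top ENNReal.ofReal_ne_top
    (ENNReal.mul_ne_top ENNReal.ofReal_ne_top hW), fun f t => ?_⟩
  rw [lintegral_eq_tsum_cube]
  have h1 : ∀ k : Fin d → ℤ, ∫⁻ x in cube k, ‖f x‖ₑ * wt N (x - t) ≤
      c₁ * wt N (t - latticePt 1 k) * amalgamENorm 1 ∞ f := fun k => by
    calc ∫⁻ x in cube k, ‖f x‖ₑ * wt N (x - t)
        ≤ ∫⁻ x in cube k, (c₁ * wt N (t - latticePt 1 k)) * ‖f x‖ₑ := by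
          refine setLIntegral_mono' (measurableSet_cube k) fun x hx => ?_
          rw [mul_comm]
          refine mul_le_mul_left ?_ _
          have hx1 : ‖latticePt 1 k - x‖ ≤ 1 := by
            rw [pi_norm_le_iff_of_nonneg zero_le_one]
            intro i
            have := hx i
            rw [Pi.sub_apply, latticePt, one_mul, Real.norm_eq_abs, abs_le]
            constructor <;> linarith
          have := wt_sub_le N (latticePt 1 k - t) (latticePt 1 k - x)
          rw [sub_sub_sub_cancel_left, ← neg_sub t (latticePt 1 k), wt_neg] at this
          refine this.trans (mul_le_mul_left (ENNReal.ofReal_le_ofReal ?_) _)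
          gcongr
      _ ≤ _ := by
          rw [lintegral_const_mul' _ _ (ENNReal.mul_ne_top ENNReal.ofReal_ne_top
            ((wt_le_one _ _).trans_lt ENNReal.one_lt_top).ne)]
          exact mul_le_mul_right (setLIntegral_cube_le f k) _
  refine (ENNReal.tsum_le_tsum h1).trans ?_
  rw [ENNReal.tsum_mul_right, ENNReal.tsum_mul_left]
  exact mul_le_mul_left (mul_le_mul_right
    ((isLatticeMap_latticePt one_pos).tsum_wt_le one_pos N t) _) _

theorem HasDecay.exists_lintegral_mul_tfShift_le {N : ℕ} (hN : d < N) {g f : (Fin d → ℝ) → ℂ}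
    (hg : HasDecay N g) (hf : AEStronglyMeasurable f volume) (hfA : amalgamENorm 1 ∞ f ≠ ∞) :
    ∃ C : ℝ≥0∞, C ≠ ∞ ∧ ∀ t ω, ∫⁻ x, ‖f x * conj (tfShift t ω g x)‖ₑ ≤ C := by
  obtain ⟨ν, hν, h⟩ := hg
  obtain ⟨C, hC, hCf⟩ := exists_lintegral_mul_wt_le hN
  refine ⟨C * amalgamENorm 1 ∞ f * ν Set.univ, ENNReal.mul_ne_top (ENNReal.mul_ne_top hC hfA)
    (measure_ne_top ν _), fun t ω => ?_⟩
  calc ∫⁻ x, ‖f x * conj (tfShift t ω g x)‖ₑ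
      ≤ ∫⁻ x, ∫⁻ u, ‖f x‖ₑ * wt N (x - (t + u)) ∂ν := by
        refine lintegral_mono fun x => ?_
        rw [enorm_mul, RCLike.enorm_conj, tfShift_apply, enorm_mul, enorm_chr, one_mul,
          lintegral_const_mul' _ _ enorm_ne_top]
        simp_rw [← sub_sub]
        exact mul_le_mul_right (h _) _
    _ = ∫⁻ u, (∫⁻ x, ‖f x‖ₑ * wt N (x - (t + u))) ∂ν := by
        refine lintegral_lintegral_swap ?_
        exact (hf.enorm.comp_fst (ν := ν)).mul (Measurable.wt (by fun_prop)).aemeasurable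
    _ ≤ ∫⁻ _, C * amalgamENorm 1 ∞ f ∂ν := lintegral_mono fun u => hCf f (t + u)
    _ = _ := lintegral_const _

/-! ### Poisson summation -/

/-- Take `ρ = ν * wt`. Peetre's inequality frees the lattice argument from the integration variable
`y` at a polynomial price in `y`; this serves the local uniform convergence of periodizations and
the summability of the kernel. -/
theorem HasDecay.exists_majorant {G : Type*} [NormedAddCommGroup G] [MeasurableSpace G]
    [BorelSpace G] {N : ℕ} {F : G → ℂ} (hF : HasDecay N F) :
    ∃ ρ : G → ℝ≥0∞, (∀ y v, ‖F (y + v)‖ₑ ≤ ENNReal.ofReal ((1 + ‖y‖) ^ N) * ρ v) ∧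
      ∀ {K : Type} [NormedAddCommGroup K] [Countable K] {s : ℝ} {T : K → G}, 0 < s →
        IsLatticeMap s T → ∑' k : K, wt N k ≠ ∞ →
          ∃ C : ℝ≥0∞, C ≠ ∞ ∧ ∀ z, ∑' k, ρ (z + T k) ≤ C := by
  obtain ⟨ν, hν, h⟩ := hF
  refine ⟨fun v => ∫⁻ u, wt N (v - u) ∂ν, fun y v => (h _).trans ?_, fun {K} _ _ s T hs hT hN => ?_⟩
  · rw [← lintegral_const_mul' _ _ ENNReal.ofReal_ne_top]
    refine lintegral_mono fun u => ?_
    have := wt_sub_le N (v - u) (-y)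
    rw [norm_neg, sub_neg_eq_add] at this
    rwa [add_sub_assoc, add_comm y]
  · exact ⟨_, ENNReal.mul_ne_top (ENNReal.mul_ne_top ENNReal.ofReal_ne_top hN)
      (measure_ne_top ν _), fun z => tsum_lintegral_wt_le hs hT N ν z⟩

theorem volume_cube (k : Fin d → ℤ) : volume (cube k) = 1 := by
  have : cube k = Set.pi Set.univ fun i => Set.Ico (k i : ℝ) (k i + 1) := by
    ext x; simp [cube]
  rw [this, volume_pi_pi]
  simp

theorem HasDecay.integrable {N : ℕ} (hN : d < N) {F : (Fin d → ℝ) → ℂ} (hF : HasDecay N F)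
    (hm : AEStronglyMeasurable F volume) : Integrable F := by
  refine ⟨hm, ?_⟩
  have h1 : amalgamENorm 1 ∞ (fun _ : Fin d → ℝ => (1 : ℂ)) ≠ ∞ := by
    rw [amalgamENorm_top]
    refine ne_top_of_le_ne_top ENNReal.one_ne_top (iSup_le fun k => ?_)
    rw [eLpNorm_indicator_const (measurableSet_cube k) one_ne_zero ENNReal.one_ne_top, volume_cube]
    simp
  obtain ⟨C, hC, h⟩ := hF.exists_lintegral_mul_tfShift_le hN aestronglyMeasurable_const h1
  refine lt_of_le_of_lt (le_trans (le_of_eq ?_) (h 0 0)) hC.lt_top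
  congr 1; ext x
  rw [one_mul, RCLike.enorm_conj, tfShift_apply, chr_zero_left, one_mul, sub_zero]

/-- The unit cube with corner `k`, closed on the right. -/
def cubeIoc (k : Fin d → ℤ) : Set (Fin d → ℝ) :=
  {x | ∀ i, x i ∈ Set.Ioc (k i : ℝ) (k i + 1)}

theorem measurableSet_cubeIoc (k : Fin d → ℤ) : MeasurableSet (cubeIoc k) :=
  MeasurableSet.univ_pi' fun _ => measurableSet_Ioc

theorem pairwise_disjoint_cubeIoc : Pairwise (Function.onFun Disjoint (cubeIoc (d := d))) := by
  intro k k' hne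
  rw [Function.onFun, Set.disjoint_left]
  intro x hx hx'
  apply hne
  ext i
  obtain ⟨h1, h2⟩ := hx i
  obtain ⟨h1', h2'⟩ := hx' i
  have h3 : (k i : ℝ) < k' i + 1 := by linarith
  have h4 : (k' i : ℝ) < k i + 1 := by linarith
  norm_cast at h3 h4
  omega

theorem iUnion_cubeIoc : ⋃ k, cubeIoc (d := d) k = Set.univ := by
  refine Set.eq_univ_of_forall fun x => Set.mem_iUnion.2 ⟨fun i => ⌈x i⌉ - 1, fun i => ?_⟩
  push_cast
  constructor <;> linarith [Int.ceil_lt_add_one (x i), Int.le_ceil (x i)]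

theorem preimage_cubeIoc (k : Fin d → ℤ) :
    (fun x => x + latticePt 1 k) ⁻¹' cubeIoc k = cubeIoc 0 := by
  ext x
  simp only [cubeIoc, Set.mem_preimage, Set.mem_ofPred_eq, Pi.add_apply, latticePt, one_mul,
    Set.mem_Ioc, Pi.zero_apply, Int.cast_zero, zero_add]
  refine forall_congr' fun i => ⟨fun h => ⟨by linarith [h.1], by linarith [h.2]⟩,
    fun h => ⟨by linarith [h.1], by linarith [h.2]⟩⟩

theorem setIntegral_cubeIoc {X : Type*} [NormedAddCommGroup X] [NormedSpace ℝ X]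
    (F : (Fin d → ℝ) → X) (k : Fin d → ℤ) :
    ∫ x in cubeIoc k, F x = ∫ x in cubeIoc 0, F (x + latticePt 1 k) := by
  rw [← preimage_cubeIoc k]
  exact ((measurePreserving_add_right volume (latticePt 1 k)).setIntegral_preimage_emb
    (measurableEmbedding_addRight _) _ _).symm

/-- Unfolding an integral over `ℝ^d` to an integral of the periodization over the unit cube. -/
theorem integral_eq_setIntegral_tsum {F : (Fin d → ℝ) → ℂ} (hF : Integrable F) :
    ∫ x, F x = ∫ x in cubeIoc 0, ∑' k : Fin d → ℤ, F (x + latticePt 1 k) := by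
  have h1 := hasSum_integral_iUnion measurableSet_cubeIoc pairwise_disjoint_cubeIoc
    (hF.integrableOn (s := ⋃ k, cubeIoc k))
  have h2 := hasSum_integral_iUnion measurableSet_cubeIoc pairwise_disjoint_cubeIoc
    (hF.norm.integrableOn (s := ⋃ k, cubeIoc k))
  rw [funext fun k => setIntegral_cubeIoc F k] at h1
  rw [funext fun k => setIntegral_cubeIoc (fun x => ‖F x‖) k] at h2
  rw [iUnion_cubeIoc, Measure.restrict_univ] at h1
  have h3 := hasSum_integral_of_summable_integral_norm
    (F := fun (k : Fin d → ℤ) x => F (x + latticePt 1 k)) (μ := volume.restrict (cubeIoc 0))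
    (fun k => (hF.comp_add_right _).integrableOn) h2.summable
  exact h1.unique h3

theorem isOpenQuotientMap_torus :
    IsOpenQuotientMap fun (x : Fin d → ℝ) => (fun i => (x i : UnitAddCircle) :
      UnitAddTorus (Fin d)) :=
  IsOpenQuotientMap.piMap fun _ => QuotientAddGroup.isOpenQuotientMap_mk

theorem exists_add_latticePt {x y : Fin d → ℝ}
    (h : ∀ i, (x i : UnitAddCircle) = (y i : UnitAddCircle)) :
    ∃ k : Fin d → ℤ, x = y + latticePt 1 k := by
  have : ∀ i, ∃ n : ℤ, n • (1 : ℝ) = x i - y i := fun i => by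
    rw [← AddCircle.coe_eq_zero_iff, AddCircle.coe_sub, h i, sub_self]
  choose k hk using this
  refine ⟨k, ?_⟩
  ext i
  have := hk i
  simp only [zsmul_eq_mul, mul_one] at this
  simp only [Pi.add_apply, latticePt, one_mul]
  linarith

theorem mFourier_coe (l : Fin d → ℤ) (x : Fin d → ℝ) :
    UnitAddTorus.mFourier l (fun i => (x i : UnitAddCircle)) = chr (latticePt 1 l) x := by
  simp only [UnitAddTorus.mFourier, ContinuousMap.coe_mk, fourier_coe_apply]
  rw [← Complex.exp_sum, chr]
  congr 1
  simp only [dotProduct, latticePt, one_mul]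
  push_cast
  rw [Finset.mul_sum]
  exact Finset.sum_congr rfl fun i _ => by ring

theorem chr_latticePt_add (l k : Fin d → ℤ) (x : Fin d → ℝ) :
    chr (latticePt 1 l) (x + latticePt 1 k) = chr (latticePt 1 l) x := by
  rw [← mFourier_coe, ← mFourier_coe]
  congr 1; ext i
  simp [latticePt]

theorem summable_of_tsum_enorm_ne_top {ι : Type*} {f : ι → ℂ} (h : ∑' i, ‖f i‖ₑ ≠ ∞) :
    Summable fun i => ‖f i‖ := by
  have := ENNReal.summable_toReal h
  simpa using this

theorem continuous_tsum_latticePt {N : ℕ} (hN : d < N) {H : (Fin d → ℝ) → ℂ} (hc : Continuous H)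
    (hH : HasDecay N H) : Continuous fun x => ∑' k : Fin d → ℤ, H (x + latticePt 1 k) := by
  obtain ⟨ρ, h1, h2⟩ := hH.exists_majorant
  obtain ⟨C, hC, h3⟩ := h2 one_pos (isLatticeMap_latticePt one_pos)
    (tsum_wt_pi_ne_top (ι := Fin d) (by simpa using hN))
  have h4 : ∑' k, ρ (latticePt 1 k) ≠ ∞ := ne_top_of_le_ne_top hC (by simpa using h3 0)
  rw [continuous_iff_continuousAt]
  intro x
  refine ContinuousOn.continuousAt (s := Metric.ball 0 (‖x‖ + 1)) ?_
    (Metric.isOpen_ball.mem_nhds (by simp))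
  refine continuousOn_tsum (u := fun k => (1 + (‖x‖ + 1)) ^ N * (ρ (latticePt 1 k)).toReal)
    (fun k => by fun_prop) ((ENNReal.summable_toReal h4).mul_left _) fun k y hy => ?_
  have hy' : ‖y‖ ≤ ‖x‖ + 1 := by simpa using (Metric.mem_ball.1 hy).le
  have h5 := ENNReal.ne_top_of_tsum_ne_top h4 k
  rw [← toReal_enorm]
  refine (ENNReal.toReal_mono (ENNReal.mul_ne_top ENNReal.ofReal_ne_top h5) (h1 y _)).trans ?_
  rw [ENNReal.toReal_mul, ENNReal.toReal_ofReal (by positivity)]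
  gcongr

/-- The periodization is continuous and descends to the torus; unfolding shows that its Fourier
coefficients are the samples of the Fourier transform of `H`. Summable coefficients make the Fourier
series of a continuous function converge to it at every point. -/
theorem poisson_unit {N : ℕ} (hN : d < N) {H : (Fin d → ℝ) → ℂ} (hc : Continuous H)
    (hH : HasDecay N H)
    (hs : Summable fun l : Fin d → ℤ => ∫ y, H y * conj (chr (latticePt 1 l) y))
    (x : Fin d → ℝ) :
    HasSum (fun l : Fin d → ℤ =>
      (∫ y, H y * conj (chr (latticePt 1 l) y)) * chr (latticePt 1 l) x)
      (∑' k : Fin d → ℤ, H (x + latticePt 1 k)) := by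
  set P : (Fin d → ℝ) → ℂ := fun x => ∑' k : Fin d → ℤ, H (x + latticePt 1 k) with hP
  have hPc : Continuous P := continuous_tsum_latticePt hN hc hH
  have hper : ∀ x k, P (x + latticePt 1 k) = P x := fun x k => by
    simp only [hP]
    rw [← (Equiv.addLeft k).tsum_eq fun j => H (x + latticePt 1 j)]
    refine tsum_congr fun j => ?_
    congr 1
    ext i; simp [latticePt]; ring
  have hq := isOpenQuotientMap_torus (d := d)
  set q : (Fin d → ℝ) → UnitAddTorus (Fin d) := fun x i => (x i : UnitAddCircle)
  -- The chosen section of the quotient is not continuous, but it differs from `x` by a lattice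
  -- vector, which `P` does not see.
  have hlift : ∀ x, P (Function.surjInv hq.surjective (q x)) = P x := fun x => by
    obtain ⟨k, hk⟩ := exists_add_latticePt (x := Function.surjInv hq.surjective (q x)) (y := x)
      fun i => congr_fun (Function.surjInv_eq hq.surjective (q x)) i
    rw [hk, hper]
  let P' : C(UnitAddTorus (Fin d), ℂ) := ⟨fun t => P (Function.surjInv hq.surjective t), by
    rw [hq.isQuotientMap.continuous_iff]
    exact hPc.congr fun x => (hlift x).symm⟩
  have hP' : ∀ x, P' (q x) = P x := hlift
  have hint : Integrable H := hH.integrable hN hc.aestronglyMeasurable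
  have hcoef : UnitAddTorus.mFourierCoeff P' =
      fun l => ∫ y, H y * conj (chr (latticePt 1 l) y) := by
    ext l
    have hi : Integrable fun y => H y * conj (chr (latticePt 1 l) y) := by
      simp_rw [← chr_neg_left]; exact integrable_mul_chr hint _
    rw [UnitAddTorus.mFourierCoeff_eq_integral _ _ 0, integral_eq_setIntegral_tsum hi]
    have hset : {x : Fin d → ℝ | ∀ i, x i ∈ Set.Ioc ((0 : Fin d → ℝ) i) ((0 : Fin d → ℝ) i + 1)} =
        cubeIoc 0 := by ext x; simp [cubeIoc]
    rw [hset]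
    congr 1; ext x
    have e1 : P' (fun i => (x i : UnitAddCircle)) = P x := hP' x
    rw [e1, mFourier_coe, latticePt_neg, chr_neg_left]
    simp_rw [chr_latticePt_add]
    rw [tsum_mul_right, smul_eq_mul, mul_comm]
  have := UnitAddTorus.hasSum_mFourier_series_apply_of_summable (f := P')
    (by rw [hcoef]; exact hs) (q x)
  rw [hP', hcoef] at this
  simpa only [smul_eq_mul, q, mFourier_coe] using this

theorem HasDecay.comp_smul {N : ℕ} {H : (Fin d → ℝ) → ℂ} (hH : HasDecay N H) {a : ℝ}
    (ha : 0 < a) : HasDecay N fun x => H (a • x) := by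
  obtain ⟨ν, hν, h⟩ := hH
  refine HasDecay.of_le_lintegral (μ := ν) (π := fun u => a⁻¹ • u) (C := ((min 1 a) ^ N)⁻¹)
    (by fun_prop) fun z => (h _).trans (lintegral_mono fun u => wt_le_of_le (by positivity) ?_)
  have h1 : a * ‖z - a⁻¹ • u‖ = ‖a • z - u‖ := by
    rw [← Real.norm_of_nonneg ha.le, ← norm_smul, smul_sub, smul_smul, Real.norm_of_nonneg ha.le,
      mul_inv_cancel₀ ha.ne', one_smul]
  rw [← h1]
  have h2 : min 1 a ≤ 1 := min_le_left _ _
  have h3 : min 1 a * ‖z - a⁻¹ • u‖ ≤ a * ‖z - a⁻¹ • u‖ :=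
    mul_le_mul_of_nonneg_right (min_le_right _ _) (norm_nonneg _)
  linarith

/-- The Poisson summation formula for the lattice `a ℤ^d`. -/
theorem poisson {N : ℕ} (hN : d < N) {H : (Fin d → ℝ) → ℂ} (hc : Continuous H)
    (hH : HasDecay N H) {a : ℝ} (ha : 0 < a)
    (hs : Summable fun l : Fin d → ℤ => ∫ y, H y * conj (chr (latticePt (1 / a) l) y))
    (x : Fin d → ℝ) :
    HasSum (fun l : Fin d → ℤ =>
      (∫ y, H y * conj (chr (latticePt (1 / a) l) y)) * chr (latticePt (1 / a) l) x)
      ((a : ℂ) ^ d * ∑' k : Fin d → ℤ, H (x + latticePt a k)) := by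
  have ha' : (a : ℂ) ≠ 0 := by exact_mod_cast ha.ne'
  have hchr : ∀ (l : Fin d → ℤ) y, chr (latticePt 1 l) y = chr (latticePt (1 / a) l) (a • y) := by
    intro l y
    unfold chr
    congr 3
    simp only [dotProduct, latticePt, Pi.smul_apply, smul_eq_mul]
    refine Finset.sum_congr rfl fun i _ => ?_
    field_simp
  have hint : ∀ l : Fin d → ℤ, ∫ y, H (a • y) * conj (chr (latticePt 1 l) y) =
      ((a : ℂ) ^ d)⁻¹ * ∫ y, H y * conj (chr (latticePt (1 / a) l) y) := by
    intro l
    simp_rw [hchr]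
    rw [Measure.integral_comp_smul volume
      (fun y => H y * conj (chr (latticePt (1 / a) l) y)) a, Complex.real_smul]
    congr 1
    rw [abs_of_pos (by positivity)]
    simp
  have h1 := poisson_unit hN (H := fun y => H (a • y)) (by fun_prop) (hH.comp_smul ha)
    (by simp_rw [hint]; exact hs.mul_left _) (a⁻¹ • x)
  have h2 := h1.mul_left ((a : ℂ) ^ d)
  simp_rw [hint, hchr, smul_add, smul_smul, mul_inv_cancel₀ ha.ne', one_smul] at h2
  have h3 : ∀ k : Fin d → ℤ, a • latticePt 1 k = latticePt a k := fun k => by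
    ext i; simp [latticePt]
  simp_rw [h3] at h2
  refine h2.congr_fun ?_
  intro l
  field_simp

/-! ### The Wiener amalgam space: embeddings, completeness, time-frequency shifts -/

theorem le_eLpNorm_count {q : ℝ≥0∞} (hq0 : q ≠ 0) (φ : (Fin d → ℤ) → ℝ≥0∞) (k : Fin d → ℤ) :
    φ k ≤ eLpNorm φ q Measure.count := by
  by_cases hq : q = ∞
  · subst hq
    rw [eLpNorm_exponent_top, eLpNormEssSup]
    simpa using le_iSup φ k
  · have hpos : 0 < q.toReal := ENNReal.toReal_pos hq0 hq
    rw [eLpNorm_eq_lintegral_rpow_enorm_toReal hq0 hq, lintegral_count]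
    simp only [enorm_eq_self]
    calc φ k = (φ k ^ q.toReal) ^ (1 / q.toReal) := by
          rw [← ENNReal.rpow_mul, mul_one_div_cancel hpos.ne', ENNReal.rpow_one]
      _ ≤ _ := ENNReal.rpow_le_rpow (ENNReal.le_tsum (f := fun k => φ k ^ q.toReal) k)
          (by positivity)

theorem eLpNorm_cube_le {p q : ℝ≥0∞} (hq0 : q ≠ 0) (f : (Fin d → ℝ) → ℂ) (k : Fin d → ℤ) :
    eLpNorm ((cube k).indicator f) p volume ≤ amalgamENorm p q f :=
  le_eLpNorm_count hq0 (fun k => eLpNorm ((cube k).indicator f) p volume) k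

/-- Cubes have volume one, so local `L^p` norms increase with `p`, and each local norm is at most
the `ℓ^q` norm. All estimates for the Gabor series can therefore be made in the largest space
`W(L^1, ℓ^∞)`. -/
theorem amalgamENorm_one_top_le {p q : ℝ≥0∞} (hp : 1 ≤ p) (hq0 : q ≠ 0) {f : (Fin d → ℝ) → ℂ}
    (hf : AEStronglyMeasurable f volume) : amalgamENorm 1 ∞ f ≤ amalgamENorm p q f := by
  rw [amalgamENorm_top]
  refine iSup_le fun k => le_trans ?_ (eLpNorm_cube_le hq0 f k)
  have : IsProbabilityMeasure (volume.restrict (cube k)) := ⟨by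
    rw [Measure.restrict_apply_univ, volume_cube]⟩
  rw [eLpNorm_indicator_eq_eLpNorm_restrict (measurableSet_cube k),
    eLpNorm_indicator_eq_eLpNorm_restrict (measurableSet_cube k)]
  exact eLpNorm_le_eLpNorm_of_exponent_le hp hf.restrict

/-- In each coordinate `y i` lies in `[k i - ⌈t i⌉, k i - ⌈t i⌉ + 2)`, which consists of two unit
intervals. A translated cube thus meets at most `2^d` integer cubes, which is the source of the
factor `2^d` in `amalgamENorm_tfShift_le`. -/
theorem exists_cube_shift (k : Fin d → ℤ) (t y : Fin d → ℝ) (h : y + t ∈ cube k) :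
    ∃ ε : Fin d → Fin 2, y ∈ cube (k + fun i => ((ε i : ℕ) : ℤ) - ⌈t i⌉) := by
  have h1 := fun i => h i
  simp only [Pi.add_apply] at h1
  refine ⟨fun i => if (k i : ℝ) - ⌈t i⌉ + 1 ≤ y i then 1 else 0, fun i => ?_⟩
  have h2 := Int.le_ceil (t i)
  have h3 := Int.ceil_lt_add_one (t i)
  obtain ⟨h4, h5⟩ := h1 i
  simp only [Pi.add_apply]
  split_ifs with hc
  · push_cast
    constructor <;> simp only [Fin.val_one, Nat.cast_one] <;> linarith
  · push_cast
    constructor <;> simp only [Fin.val_zero, Nat.cast_zero] <;> linarith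

theorem amalgamENorm_tfShift_le {p q : ℝ≥0∞} (hp : 1 ≤ p) (hq : 1 ≤ q) {f : (Fin d → ℝ) → ℂ}
    (hf : AEStronglyMeasurable f volume) (t ω : Fin d → ℝ) :
    amalgamENorm p q (tfShift t ω f) ≤ 2 ^ d * amalgamENorm p q f := by
  set S : (Fin d → Fin 2) → Fin d → ℤ := fun ε i => ((ε i : ℕ) : ℤ) - ⌈t i⌉
  set n : (Fin d → ℤ) → ℝ≥0∞ := fun k => eLpNorm ((cube k).indicator f) p volume
  have h1 : ∀ k, eLpNorm ((cube k).indicator (tfShift t ω f)) p volume ≤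
      ∑ ε, n (k + S ε) := fun k => by
    set A : Set (Fin d → ℝ) := {y | y + t ∈ cube k}
    have hA : MeasurableSet A := (measurableSet_cube k).preimage (by fun_prop)
    have e1 : eLpNorm ((cube k).indicator (tfShift t ω f)) p volume =
        eLpNorm (A.indicator f ∘ fun x => x - t) p volume := by
      refine eLpNorm_congr_norm_ae (ae_of_all _ fun x => ?_)
      by_cases hx : x ∈ cube k
      · rw [Set.indicator_of_mem hx, Function.comp_apply,
          Set.indicator_of_mem (by simpa [A] using hx), tfShift_apply, norm_mul, norm_chr, one_mul]
      · rw [Set.indicator_of_notMem hx, Function.comp_apply,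
          Set.indicator_of_notMem (by simpa [A] using hx)]
    rw [e1, eLpNorm_comp_measurePreserving (hf.indicator hA) (measurePreserving_sub_right volume t)]
    have e2 : eLpNorm (A.indicator f) p volume ≤
        eLpNorm (∑ ε, fun y => ‖(cube (k + S ε)).indicator f y‖) p volume := by
      refine eLpNorm_mono_real fun y => ?_
      rw [Finset.sum_apply]
      by_cases hy : y ∈ A
      · obtain ⟨ε, hε⟩ := exists_cube_shift k t y hy
        rw [Set.indicator_of_mem hy, ← Set.indicator_of_mem hε f]
        exact Finset.single_le_sum (f := fun ε => ‖(cube (k + S ε)).indicator f y‖)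
          (fun _ _ => norm_nonneg _) (Finset.mem_univ ε)
      · rw [Set.indicator_of_notMem hy, norm_zero]
        exact Finset.sum_nonneg fun _ _ => norm_nonneg _
    refine e2.trans ((eLpNorm_sum_le (fun ε _ => (hf.indicator (measurableSet_cube _)).norm)
      hp).trans (Finset.sum_le_sum fun ε _ => ?_))
    rw [eLpNorm_norm]
  have h2 : ∀ ε, eLpNorm (fun k => n (k + S ε)) q Measure.count = amalgamENorm p q f := fun ε =>
    eLpNorm_comp_measurePreserving (g := n) (measurable_of_countable _).aestronglyMeasurable
      (measurePreserving_add_right Measure.count (S ε))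
  calc amalgamENorm p q (tfShift t ω f)
      ≤ eLpNorm (∑ ε, fun k => n (k + S ε)) q Measure.count := by
        refine eLpNorm_mono_enorm fun k => ?_
        simp only [enorm_eq_self, Finset.sum_apply]
        exact h1 k
    _ ≤ ∑ ε, eLpNorm (fun k => n (k + S ε)) q Measure.count :=
        eLpNorm_sum_le (fun ε _ => (measurable_of_countable _).aestronglyMeasurable) hq
    _ = _ := by
        simp_rw [h2]
        simp

theorem aestronglyMeasurable_tfShift {f : (Fin d → ℝ) → ℂ} (hf : AEStronglyMeasurable f volume)
    (t ω : Fin d → ℝ) : AEStronglyMeasurable (tfShift t ω f) volume :=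
  (Continuous.aestronglyMeasurable (f := fun x => chr ω x) (by fun_prop)).mul
    (hf.comp_quasiMeasurePreserving
      (measurePreserving_sub_right volume t).quasiMeasurePreserving)

/-! ### The amalgam space as a Banach space: completeness, shift operators, test functionals. -/

section AmalgamSpace

variable {p q : ℝ≥0∞} [hp : Fact (1 ≤ p)] [hq : Fact (1 ≤ q)]

/-- The representative of an element of the amalgam space. -/
noncomputable abbrev rep (f : Amalgam d p q) : (Fin d → ℝ) → ℂ := (f : (Fin d → ℝ) →ₘ[volume] ℂ)

theorem Amalgam.norm_def (f : Amalgam d p q) : ‖f‖ = (amalgamENorm p q (rep f)).toReal := rfl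

theorem Amalgam.amalgamENorm_ne_top (f : Amalgam d p q) : amalgamENorm p q (rep f) ≠ ∞ := ne_of_lt f.2

theorem Amalgam.ofReal_norm (f : Amalgam d p q) : ENNReal.ofReal ‖f‖ = amalgamENorm p q (rep f) := by
  rw [Amalgam.norm_def, ENNReal.ofReal_toReal (Amalgam.amalgamENorm_ne_top f)]

theorem Amalgam.aestronglyMeasurable (f : Amalgam d p q) : AEStronglyMeasurable (rep f) volume :=
  AEEqFun.aestronglyMeasurable _

theorem Amalgam.rep_sub (f g : Amalgam d p q) : (rep (f - g)) =ᵐ[volume] (rep f) - (rep g) :=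
  AEEqFun.coeFn_sub _ _

theorem Amalgam.rep_add (f g : Amalgam d p q) : (rep (f + g)) =ᵐ[volume] (rep f) + (rep g) :=
  AEEqFun.coeFn_add _ _

theorem Amalgam.rep_smul (c : ℂ) (f : Amalgam d p q) : (rep (c • f)) =ᵐ[volume] c • (rep f) :=
  AEEqFun.coeFn_smul _ _

/-- The element of the amalgam space defined by a function of finite amalgam norm. -/
noncomputable def Amalgam.mk (f : (Fin d → ℝ) → ℂ) (hf : AEStronglyMeasurable f volume)
    (h : amalgamENorm p q f < ∞) : Amalgam d p q :=
  ⟨AEEqFun.mk f hf, by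
    change amalgamENorm p q _ < ∞
    rwa [amalgamENorm_congr p q (AEEqFun.coeFn_mk f hf)]⟩

theorem Amalgam.rep_mk {f : (Fin d → ℝ) → ℂ} (hf : AEStronglyMeasurable f volume)
    (h : amalgamENorm p q f < ∞) : rep (Amalgam.mk f hf h) =ᵐ[volume] f :=
  AEEqFun.coeFn_mk f hf

theorem Amalgam.ext_rep {f g : Amalgam d p q} (h : (rep f) =ᵐ[volume] (rep g)) : f = g :=
  Subtype.ext (AEEqFun.ext h)

theorem one_le_ne_zero {p : ℝ≥0∞} (hp : 1 ≤ p) : p ≠ 0 := (zero_lt_one.trans_le hp).ne'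

theorem Amalgam.memLp_cube (f : Amalgam d p q) (k : Fin d → ℤ) :
    MemLp ((cube k).indicator (rep f)) p volume :=
  ⟨(Amalgam.aestronglyMeasurable f).indicator (measurableSet_cube k),
    (eLpNorm_cube_le (one_le_ne_zero hq.out) _ k).trans_lt f.2⟩

/-- The sequence of local pieces of an element of the amalgam space. -/
noncomputable def Amalgam.pieces (f : Amalgam d p q) (k : Fin d → ℤ) :
    Lp ℂ p (volume : Measure (Fin d → ℝ)) :=
  (Amalgam.memLp_cube f k).toLp _

theorem Amalgam.eLpNorm_pieces (f : Amalgam d p q) :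
    eLpNorm (Amalgam.pieces f) q Measure.count = amalgamENorm p q (rep f) := by
  refine eLpNorm_congr_enorm_ae (ae_of_all _ fun k => ?_)
  rw [enorm_eq_self, Amalgam.pieces, Lp.enorm_toLp]

theorem Amalgam.pieces_sub (f g : Amalgam d p q) : (Amalgam.pieces (f - g)) = (Amalgam.pieces f) - (Amalgam.pieces g) := by
  ext1 k
  rw [Pi.sub_apply]
  refine Eq.trans ?_ (MemLp.toLp_sub (Amalgam.memLp_cube f k) (Amalgam.memLp_cube g k))
  rw [Amalgam.pieces, MemLp.toLp_eq_toLp_iff]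
  filter_upwards [Amalgam.rep_sub f g] with x hx
  by_cases h : x ∈ cube k <;> simp [h, hx]

theorem floor_eq_of_mem_cube {k : Fin d → ℤ} {x : Fin d → ℝ} (h : x ∈ cube k) :
    (fun i => ⌊x i⌋) = k := by
  ext i
  rw [Int.floor_eq_iff]
  exact h i

/-- The map to local pieces is an isometry into `ℓ^q(L^p)`, where limits exist. Completeness is
needed to sum Janssen's series in operator norm. -/
instance Amalgam.instCompleteSpace : CompleteSpace (Amalgam d p q) := by
  refine Metric.complete_of_convergent_controlled_sequences (fun n => (1 / 2 : ℝ) ^ n)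
    (fun n => by positivity) fun u hu => ?_
  have hmem : ∀ n, MemLp (Amalgam.pieces (u n)) q Measure.count := fun n =>
    ⟨StronglyMeasurable.of_discrete.aestronglyMeasurable, by
      rw [Amalgam.eLpNorm_pieces]; exact (u n).2⟩
  obtain ⟨F, hF, hlim⟩ := Lp.cauchy_complete_eLpNorm (μ := Measure.count) (p := q)
    (f := fun n => (Amalgam.pieces (u n))) hq.out hmem (B := fun n => ENNReal.ofReal ((1 / 2 : ℝ) ^ n))
    (by
      rw [← ENNReal.ofReal_tsum_of_nonneg (fun n => by positivity) summable_geometric_two]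
      exact ENNReal.ofReal_ne_top)
    (fun N n m hn hm => by
      change eLpNorm ((Amalgam.pieces (u n)) - (Amalgam.pieces (u m))) _ _ < _
      rw [← Amalgam.pieces_sub, Amalgam.eLpNorm_pieces, ← Amalgam.ofReal_norm, ← dist_eq_norm]
      exact (ENNReal.ofReal_lt_ofReal_iff (by positivity)).2 (hu N n m hn hm))
  -- Only the restriction of `F k` to its own cube is kept when gluing; the discarded parts can only
  -- decrease the distance, which is `hle`.
  set v : (Fin d → ℝ) → ℂ := fun x => (F fun i => ⌊x i⌋ : Lp ℂ p volume) x
  have hv : ∀ k x, x ∈ cube k → v x = (F k : Lp ℂ p volume) x := fun k x hx => by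
    simp only [v, floor_eq_of_mem_cube hx]
  have hvm : AEStronglyMeasurable v volume := by
    rw [← Measure.restrict_univ (μ := volume), ← iUnion_cube, aestronglyMeasurable_iUnion_iff]
    intro k
    refine (Lp.aestronglyMeasurable (F k)).restrict.congr ?_
    filter_upwards [ae_restrict_mem (measurableSet_cube k)] with x hx
    exact (hv k x hx).symm
  have hle : ∀ n, amalgamENorm p q ((rep (u n)) - v) ≤
      eLpNorm ((Amalgam.pieces (u n)) - F) q Measure.count := fun n => by
    refine eLpNorm_mono_enorm fun k => ?_
    rw [enorm_eq_self, Pi.sub_apply, Lp.enorm_def]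
    refine eLpNorm_mono_enorm_ae ?_
    filter_upwards [Lp.coeFn_sub ((Amalgam.pieces (u n)) k) (F k), (Amalgam.memLp_cube (u n) k).coeFn_toLp]
      with x h1 h2
    by_cases hx : x ∈ cube k
    · rw [Set.indicator_of_mem hx, h1, Pi.sub_apply, Pi.sub_apply, hv k x hx, Amalgam.pieces, h2,
        Set.indicator_of_mem hx]
    · rw [Set.indicator_of_notMem hx, enorm_zero]; exact zero_le
  have hvfin : amalgamENorm p q v < ∞ := by
    obtain ⟨n, hn⟩ := (hlim.eventually_lt_const (zero_lt_one (α := ℝ≥0∞))).exists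
    have e : v = (rep (u n)) + (-1 : ℂ) • ((rep (u n)) - v) := by
      ext x; simp
    rw [e]
    refine (amalgamENorm_add_le hp.out hq.out (Amalgam.aestronglyMeasurable (u n))
      (((Amalgam.aestronglyMeasurable (u n)).sub hvm).const_smul _)).trans_lt (ENNReal.add_lt_top.2
        ⟨(u n).2, ?_⟩)
    rw [amalgamENorm_smul (one_le_ne_zero hq.out)]
    exact ENNReal.mul_lt_top enorm_lt_top ((hle n).trans_lt (hn.trans ENNReal.one_lt_top))
  refine ⟨Amalgam.mk v hvm hvfin, ?_⟩
  rw [tendsto_iff_norm_sub_tendsto_zero]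
  have e : ∀ n, ‖u n - Amalgam.mk v hvm hvfin‖ = (amalgamENorm p q ((rep (u n)) - v)).toReal :=
    fun n => by
      rw [Amalgam.norm_def, amalgamENorm_congr p q ((Amalgam.rep_sub _ _).trans
        (EventuallyEq.rfl.sub (Amalgam.rep_mk hvm hvfin)))]
  simp_rw [e]
  rw [← ENNReal.toReal_zero]
  exact (ENNReal.tendsto_toReal ENNReal.zero_ne_top).comp
    (tendsto_of_tendsto_of_tendsto_of_le_of_le tendsto_const_nhds hlim (fun _ => zero_le) hle)

theorem Amalgam.amalgamENorm_lt_top (f : Amalgam d p q) : amalgamENorm p q (rep f) < ∞ := f.2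

/-- The time-frequency shift of an element of the amalgam space. -/
noncomputable def Amalgam.shift (t ω : Fin d → ℝ) (f : Amalgam d p q) : Amalgam d p q :=
  Amalgam.mk (tfShift t ω (rep f))
    (aestronglyMeasurable_tfShift (Amalgam.aestronglyMeasurable f) t ω)
    ((amalgamENorm_tfShift_le hp.out hq.out (Amalgam.aestronglyMeasurable f) t ω).trans_lt
      (ENNReal.mul_lt_top (by simp) (Amalgam.amalgamENorm_lt_top f)))

theorem Amalgam.rep_shift (t ω : Fin d → ℝ) (f : Amalgam d p q) :
    rep (Amalgam.shift t ω f) =ᵐ[volume] tfShift t ω (rep f) :=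
  Amalgam.rep_mk _ _

/-- The time-frequency shift as a bounded operator on the amalgam space. -/
noncomputable def tfShiftCLM (p q : ℝ≥0∞) [hp : Fact (1 ≤ p)] [hq : Fact (1 ≤ q)]
    (t ω : Fin d → ℝ) : Amalgam d p q →L[ℂ] Amalgam d p q :=
  LinearMap.mkContinuous
    { toFun := Amalgam.shift t ω
      map_add' := fun f g => by
        refine Amalgam.ext_rep ?_
        filter_upwards [Amalgam.rep_shift t ω (f + g), Amalgam.rep_shift t ω f,
          Amalgam.rep_shift t ω g, tfShift_congr_ae t ω (Amalgam.rep_add f g),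
          Amalgam.rep_add (Amalgam.shift t ω f) (Amalgam.shift t ω g)] with x h1 h2 h3 h4 h5
        rw [h1, h4, h5, Pi.add_apply, h2, h3]
        simp only [tfShift_apply, Pi.add_apply, mul_add]
      map_smul' := fun c f => by
        refine Amalgam.ext_rep ?_
        filter_upwards [Amalgam.rep_shift t ω (c • f), Amalgam.rep_shift t ω f,
          tfShift_congr_ae t ω (Amalgam.rep_smul c f),
          Amalgam.rep_smul c (Amalgam.shift t ω f)] with x h1 h2 h3 h4
        rw [h1, h3, RingHom.id_apply, h4, Pi.smul_apply, h2]
        simp only [Pi.smul_apply, tfShift_apply, smul_eq_mul]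
        ring }
    (2 ^ d) fun f => by
      change ‖Amalgam.shift t ω f‖ ≤ _
      rw [Amalgam.norm_def, Amalgam.norm_def, amalgamENorm_congr p q (Amalgam.rep_shift t ω f)]
      refine (ENNReal.toReal_mono (ENNReal.mul_ne_top (by simp) (Amalgam.amalgamENorm_ne_top f))
        (amalgamENorm_tfShift_le hp.out hq.out (Amalgam.aestronglyMeasurable f) t ω)).trans
          (le_of_eq ?_)
      simp

theorem rep_tfShiftCLM (t ω : Fin d → ℝ) (f : Amalgam d p q) :
    rep (tfShiftCLM p q t ω f) =ᵐ[volume] tfShift t ω (rep f) :=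
  Amalgam.rep_shift t ω f

theorem norm_tfShiftCLM_le (t ω : Fin d → ℝ) : ‖tfShiftCLM (d := d) p q t ω‖ ≤ 2 ^ d :=
  LinearMap.mkContinuous_norm_le _ (by positivity) _

theorem tfShiftCLM_zero : tfShiftCLM (d := d) p q 0 0 = ContinuousLinearMap.id ℂ _ := by
  ext1 f
  refine Amalgam.ext_rep ((rep_tfShiftCLM 0 0 f).trans (ae_of_all _ fun x => ?_))
  simp [tfShift_apply]

theorem Amalgam.amalgamENorm_one_top_ne_top (f : Amalgam d p q) : amalgamENorm 1 ∞ (rep f) ≠ ∞ :=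
  ne_top_of_le_ne_top (Amalgam.amalgamENorm_ne_top f)
    (amalgamENorm_one_top_le hp.out (one_le_ne_zero hq.out) (Amalgam.aestronglyMeasurable f))

theorem exists_lintegral_mul_test_le {h : (Fin d → ℝ) → ℂ} (hh : Continuous h)
    (hhc : HasCompactSupport h) : ∃ C : ℝ≥0∞, C ≠ ∞ ∧ ∀ f : (Fin d → ℝ) → ℂ,
      ∫⁻ x, ‖f x * conj (h x)‖ₑ ≤ C * amalgamENorm 1 ∞ f := by
  obtain ⟨C, hC⟩ := exists_enorm_le_mul_wt (d + 1) hh hhc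
  obtain ⟨C', hC', hle⟩ := exists_lintegral_mul_wt_le (d := d) (N := d + 1) (by omega)
  refine ⟨ENNReal.ofReal C * C', ENNReal.mul_ne_top ENNReal.ofReal_ne_top hC', fun f => ?_⟩
  calc ∫⁻ x, ‖f x * conj (h x)‖ₑ ≤ ∫⁻ x, ENNReal.ofReal C * (‖f x‖ₑ * wt (d + 1) (x - 0)) := by
        refine lintegral_mono fun x => ?_
        rw [enorm_mul, RCLike.enorm_conj, mul_left_comm, sub_zero]
        exact mul_le_mul_right (hC x) _
    _ ≤ _ := by
        rw [lintegral_const_mul' _ _ ENNReal.ofReal_ne_top, mul_assoc]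
        exact mul_le_mul_right (hle f 0) _

theorem Amalgam.integrable_mul_test {h : (Fin d → ℝ) → ℂ} (hh : Continuous h)
    (hhc : HasCompactSupport h) (f : Amalgam d p q) : Integrable fun x => (rep f) x * conj (h x) := by
  obtain ⟨C, hC, hle⟩ := exists_lintegral_mul_test_le hh hhc
  exact ⟨(Amalgam.aestronglyMeasurable f).mul (Continuous.aestronglyMeasurable (by fun_prop)),
    (hle (rep f)).trans_lt (ENNReal.mul_lt_top hC.lt_top (Amalgam.amalgamENorm_one_top_ne_top f).lt_top)⟩

theorem Amalgam.exists_pairingCLM {h : (Fin d → ℝ) → ℂ} (hh : Continuous h)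
    (hhc : HasCompactSupport h) :
    ∃ L : Amalgam d p q →L[ℂ] ℂ, ∀ f : Amalgam d p q, L f = pairing (rep f) h := by
  obtain ⟨C, hC, hle⟩ := exists_lintegral_mul_test_le hh hhc
  refine ⟨LinearMap.mkContinuous
    { toFun := fun f => pairing (rep f) h
      map_add' := fun f g => ?_
      map_smul' := fun c f => ?_ } C.toReal fun f => ?_, fun f => rfl⟩
  · rw [pairing_congr_ae (Amalgam.rep_add f g) EventuallyEq.rfl]
    unfold pairing
    rw [← integral_add (Amalgam.integrable_mul_test hh hhc f) (Amalgam.integrable_mul_test hh hhc g)]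
    simp only [Pi.add_apply, add_mul]
  · rw [pairing_congr_ae (Amalgam.rep_smul c f) EventuallyEq.rfl, RingHom.id_apply, smul_eq_mul]
    unfold pairing
    rw [← integral_const_mul]
    simp only [Pi.smul_apply, smul_eq_mul, mul_assoc]
  · change ‖pairing (rep f) h‖ ≤ _
    rw [Amalgam.norm_def, ← ENNReal.toReal_mul, ← toReal_enorm]
    refine ENNReal.toReal_mono (ENNReal.mul_ne_top hC (Amalgam.amalgamENorm_ne_top f)) ?_
    refine (enorm_integral_le_lintegral_enorm _).trans ((hle _).trans ?_)
    exact mul_le_mul_right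
      (amalgamENorm_one_top_le hp.out (one_le_ne_zero hq.out) (Amalgam.aestronglyMeasurable f)) _

/-- Elements become integrable after multiplication by `(1 + ‖x‖)^{-(d+1)}`, hence are locally
integrable, and are then determined by their integrals against test functions. -/
theorem Amalgam.ext_of_pairing {u v : Amalgam d p q}
    (h : ∀ φ : (Fin d → ℝ) → ℂ, ContDiff ℝ (⊤ : ℕ∞) φ → HasCompactSupport φ →
      pairing (rep u) φ = pairing (rep v) φ) : u = v := by
  have hloc : ∀ f : Amalgam d p q, LocallyIntegrable (rep f) := fun f => by
    obtain ⟨C, hC, hle⟩ := exists_lintegral_mul_wt_le (d := d) (N := d + 1) (by omega)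
    have hi : Integrable fun x => (rep f) x * (((1 + ‖x‖) ^ (d + 1) : ℝ) : ℂ)⁻¹ := by
      have hcont : Continuous fun x : Fin d → ℝ => (((1 + ‖x‖) ^ (d + 1) : ℝ) : ℂ)⁻¹ :=
        Continuous.inv₀ (by fun_prop) fun x => by
          have : (1 + ‖x‖) ^ (d + 1) ≠ 0 := by positivity
          exact_mod_cast this
      refine ⟨(Amalgam.aestronglyMeasurable f).mul hcont.aestronglyMeasurable, ?_⟩
      refine lt_of_le_of_lt (le_trans (le_of_eq ?_) (hle (rep f) 0))
        (ENNReal.mul_lt_top hC.lt_top (Amalgam.amalgamENorm_one_top_ne_top f).lt_top)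
      congr 1; ext x
      rw [enorm_mul, sub_zero, wt_eq_ofReal, ← Complex.ofReal_inv,
        ← _root_.ofReal_norm ((((1 + ‖x‖) ^ (d + 1))⁻¹ : ℝ) : ℂ),
        Complex.norm_of_nonneg (by positivity)]
    rw [locallyIntegrable_iff]
    intro K hK
    refine ((hi.integrableOn (s := K)).mul_continuousOn
      (g' := fun x => (((1 + ‖x‖) ^ (d + 1) : ℝ) : ℂ)) (by fun_prop) hK).congr
        (ae_of_all _ fun x => ?_)
    have : (((1 + ‖x‖) ^ (d + 1) : ℝ) : ℂ) ≠ 0 := by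
      have : (1 + ‖x‖) ^ (d + 1) ≠ 0 := by positivity
      exact_mod_cast this
    field_simp
  refine Amalgam.ext_rep (ae_eq_of_integral_contDiff_smul_eq (hloc u) (hloc v) fun r hr hrc => ?_)
  have := h (fun x => (r x : ℂ)) (Complex.ofRealCLM.contDiff.comp hr)
    (hrc.comp_left Complex.ofReal_zero)
  unfold pairing at this
  simpa [mul_comm] using this

end AmalgamSpace

/-! ### The fundamental identity of Gabor analysis -/

theorem HasDecay.of_hasCompactSupport (N : ℕ) {h : (Fin d → ℝ) → ℂ} (hh : Continuous h)
    (hhc : HasCompactSupport h) : HasDecay N h := by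
  obtain ⟨C, hC⟩ := exists_enorm_le_mul_wt N hh hhc
  refine HasDecay.of_le_lintegral (μ := Measure.dirac (0 : Fin d → ℝ)) (π := id) (C := C)
    measurable_id fun z => ?_
  rw [lintegral_dirac' _ ((Measurable.wt (by fun_prop)).const_mul _), id, sub_zero]
  exact hC z

theorem hasSum_integral_of_tsum_lintegral_ne_top {ι X : Type*} [Countable ι] [MeasurableSpace X]
    {μ : Measure X} {F : ι → X → ℂ} (hm : ∀ i, AEStronglyMeasurable (F i) μ)
    (h : ∑' i, ∫⁻ x, ‖F i x‖ₑ ∂μ ≠ ∞) :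
    HasSum (fun i => ∫ x, F i x ∂μ) (∫ x, ∑' i, F i x ∂μ) := by
  rw [integral_tsum hm h]
  refine (summable_of_tsum_enorm_ne_top (ne_top_of_le_ne_top h
    (ENNReal.tsum_le_tsum fun i => enorm_integral_le_lintegral_enorm _))).of_norm.hasSum

theorem tsum_comp_neg {K X : Type*} [AddCommGroup K] [TopologicalSpace X] [AddCommMonoid X]
    (f : K → X) : ∑' k, f (-k) = ∑' k, f k :=
  (Equiv.neg K).tsum_eq f

/-- The translated product whose integrals appear on both sides of the fundamental identity. -/
noncomputable def gaborKernel (a b : ℝ) (g γ f h : (Fin d → ℝ) → ℂ) (n j : Fin d → ℤ)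
    (y : Fin d → ℝ) : ℂ :=
  (f (y - latticePt (1 / b) j) * conj (g (y - latticePt (1 / b) j - latticePt a n))) *
    (γ (y - latticePt a n) * conj (h y))

section Janssen

variable {φ ψ γ g f h : (Fin d → ℝ) → ℂ} {c e : (Fin d → ℝ) × (Fin d → ℝ) → ℂ} {a b : ℝ}

theorem aestronglyMeasurable_gaborKernel (hγ : IsSynthesis φ c γ) (hg : IsSynthesis ψ e g)
    (hf : AEStronglyMeasurable f volume) (hh : Continuous h) (n j : Fin d → ℤ) :
    AEStronglyMeasurable (gaborKernel a b g γ f h n j) volume := by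
  have h1 := hγ.continuous
  have h2 := hg.continuous
  have h3 : AEStronglyMeasurable (transl (latticePt (1 / b) j) f) volume :=
    hf.comp_quasiMeasurePreserving
      (measurePreserving_sub_right volume _).quasiMeasurePreserving
  exact (h3.mul (Continuous.aestronglyMeasurable (by fun_prop))).mul
    (Continuous.aestronglyMeasurable (by fun_prop))

/-- The majorants replace `γ` and `g` by `ρ₁(-an)` and `ρ₂(-an - j/b)` up to polynomial factors in
`y`. Summing first in `j`, uniformly in `n`, and then in `n` gives a finite total. -/
theorem tsum_lintegral_gaborKernel_ne_top (hγ : IsSynthesis φ c γ) (hg : IsSynthesis ψ e g)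
    (hf : AEStronglyMeasurable f volume) (hfA : amalgamENorm 1 ∞ f ≠ ∞)
    (hh : Continuous h) (hhc : HasCompactSupport h) (ha : 0 < a) (hb : 0 < b) :
    ∑' nj : (Fin d → ℤ) × (Fin d → ℤ), ∫⁻ y, ‖gaborKernel a b g γ f h nj.1 nj.2 y‖ₑ ≠ ∞ := by
  set N := d + 1
  have hN : ∑' k : Fin d → ℤ, wt N k ≠ ∞ := tsum_wt_pi_ne_top (by simp [N])
  obtain ⟨ρ₁, h₁, h₁'⟩ := (hγ.hasDecay N).exists_majorant
  obtain ⟨ρ₂, h₂, h₂'⟩ := (hg.hasDecay N).exists_majorant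
  obtain ⟨C₁, hC₁, hs₁⟩ := h₁' ha (isLatticeMap_latticePt ha) hN
  obtain ⟨C₂, hC₂, hs₂⟩ := h₂' (one_div_pos.2 hb) (isLatticeMap_latticePt (one_div_pos.2 hb)) hN
  -- Compact support of `h` absorbs the two Peetre factors, one for each window.
  set h' : (Fin d → ℝ) → ℂ := fun y => h y * (((1 + ‖y‖) ^ N * (1 + ‖y‖) ^ N : ℝ) : ℂ)
  have hh' : HasDecay N h' :=
    HasDecay.of_hasCompactSupport N (by fun_prop) hhc.mul_right
  obtain ⟨C₃, hC₃, hs₃⟩ := hh'.exists_lintegral_mul_tfShift_le (by simp [N]) hf hfA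
  have key : ∀ n j : Fin d → ℤ, ∫⁻ y, ‖gaborKernel a b g γ f h n j y‖ₑ ≤
      C₃ * (ρ₁ (latticePt a (-n)) * ρ₂ (latticePt a (-n) + latticePt (1 / b) (-j))) := by
    intro n j
    by_cases htop : ρ₁ (latticePt a (-n)) * ρ₂ (latticePt a (-n) + latticePt (1 / b) (-j)) = ∞
    · exfalso
      rw [ENNReal.mul_eq_top] at htop
      rcases htop with ⟨-, ht⟩ | ⟨ht, -⟩
      · exact ENNReal.ne_top_of_tsum_ne_top (ne_top_of_le_ne_top hC₂ (hs₂ (latticePt a (-n))))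
          (-j) ht
      · have := ENNReal.ne_top_of_tsum_ne_top (ne_top_of_le_ne_top hC₁ (hs₁ 0)) (-n)
        rw [zero_add] at this
        exact this ht
    calc ∫⁻ y, ‖gaborKernel a b g γ f h n j y‖ₑ
        ≤ ∫⁻ y, (fun x => ‖f x * conj (tfShift (-latticePt (1 / b) j) 0 h' x)‖ₑ)
            (y - latticePt (1 / b) j) *
            (ρ₁ (latticePt a (-n)) * ρ₂ (latticePt a (-n) + latticePt (1 / b) (-j))) := by
          refine lintegral_mono fun y => ?_
          simp only [gaborKernel, enorm_mul, RCLike.enorm_conj, tfShift_apply, enorm_chr, one_mul,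
            sub_neg_eq_add, sub_add_cancel, h']
          have e1 := h₁ y (latticePt a (-n))
          have e2 := h₂ y (latticePt a (-n) + latticePt (1 / b) (-j))
          rw [latticePt_neg, ← sub_eq_add_neg] at e1
          rw [latticePt_neg, latticePt_neg, ← sub_eq_add_neg,
            show y + (-latticePt a n - latticePt (1 / b) j) =
              y - latticePt (1 / b) j - latticePt a n by abel] at e2
          rw [latticePt_neg, latticePt_neg, ← sub_eq_add_neg]
          have e3 : ‖(((1 + ‖y‖) ^ N * (1 + ‖y‖) ^ N : ℝ) : ℂ)‖ₑ =
              ENNReal.ofReal ((1 + ‖y‖) ^ N) * ENNReal.ofReal ((1 + ‖y‖) ^ N) := by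
            rw [← ENNReal.ofReal_mul (by positivity), ← ofReal_norm,
              Complex.norm_of_nonneg (by positivity)]
          rw [e3]
          calc ‖f (y - latticePt (1 / b) j)‖ₑ *
                ‖g (y - latticePt (1 / b) j - latticePt a n)‖ₑ *
                (‖γ (y - latticePt a n)‖ₑ * ‖h y‖ₑ)
              ≤ ‖f (y - latticePt (1 / b) j)‖ₑ * (ENNReal.ofReal ((1 + ‖y‖) ^ N) *
                  ρ₂ (-latticePt a n - latticePt (1 / b) j)) *
                ((ENNReal.ofReal ((1 + ‖y‖) ^ N) * ρ₁ (-latticePt a n)) * ‖h y‖ₑ) := by gcongr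
            _ = _ := by ring
      _ = (∫⁻ x, ‖f x * conj (tfShift (-latticePt (1 / b) j) 0 h' x)‖ₑ) *
            (ρ₁ (latticePt a (-n)) * ρ₂ (latticePt a (-n) + latticePt (1 / b) (-j))) := by
          rw [lintegral_mul_const' _ _ htop, lintegral_sub_right_eq_self
            (fun x => ‖f x * conj (tfShift (-latticePt (1 / b) j) 0 h' x)‖ₑ)]
      _ ≤ _ := mul_le_mul_left (hs₃ _ _) _
  rw [ENNReal.tsum_prod (f := fun n j => ∫⁻ y, ‖gaborKernel a b g γ f h n j y‖ₑ)]
  refine ne_top_of_le_ne_top (ENNReal.mul_ne_top hC₃ (ENNReal.mul_ne_top hC₁ hC₂))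
    ((ENNReal.tsum_le_tsum fun n => ENNReal.tsum_le_tsum fun j => key n j).trans ?_)
  simp_rw [ENNReal.tsum_mul_left]
  refine mul_le_mul_right ?_ _
  rw [tsum_comp_neg fun n => ρ₁ (latticePt a n) *
    ∑' j : Fin d → ℤ, ρ₂ (latticePt a n + latticePt (1 / b) (-j))]
  calc ∑' n, ρ₁ (latticePt a n) * ∑' j : Fin d → ℤ, ρ₂ (latticePt a n + latticePt (1 / b) (-j))
      ≤ ∑' n, ρ₁ (latticePt a n) * C₂ := by
        refine ENNReal.tsum_le_tsum fun n => mul_le_mul_right ?_ _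
        rw [tsum_comp_neg fun j => ρ₂ (latticePt a n + latticePt (1 / b) j)]
        exact hs₂ _
    _ ≤ _ := by
        rw [ENNReal.tsum_mul_right]
        refine mul_le_mul_left ?_ _
        simpa using hs₁ 0

theorem tsum_enorm_pairing_test_ne_top (hγ : IsSynthesis φ c γ) (hh : ContDiff ℝ (⊤ : ℕ∞) h)
    (hhc : HasCompactSupport h) (ha : 0 < a) (hb : 0 < b) :
    ∑' nm : (Fin d → ℤ) × (Fin d → ℤ),
      ‖pairing (tfShift (latticePt a nm.1) (latticePt b nm.2) γ) h‖ₑ ≠ ∞ := by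
  have h1 := (hγ.hasDecay_windowedFourier_test hh hhc (2 * d + 1)).tsum_ne_top
    (tsum_wt_prod_ne_top (by omega)) (lt_min ha hb) (isLatticeMap_tfLattice ha hb)
  rw [← tsum_comp_neg] at h1
  refine ne_top_of_le_ne_top h1 (ENNReal.tsum_le_tsum fun k => le_of_eq ?_)
  rw [windowedFourier, enorm_pairing_tfShift_right]
  simp [tfLattice, latticePt_neg]

/-- Summation over the modulations in the Gabor series. -/
theorem hasSum_modulations (hγ : IsSynthesis φ c γ) (hg : IsSynthesis ψ e g)
    (hf : AEStronglyMeasurable f volume) (hfA : amalgamENorm 1 ∞ f ≠ ∞)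
    (hh : ContDiff ℝ (⊤ : ℕ∞) h) (hhc : HasCompactSupport h) (ha : 0 < a) (hb : 0 < b)
    (n : Fin d → ℤ) :
    HasSum (fun m : Fin d → ℤ =>
      pairing f (tfShift (latticePt a n) (latticePt b m) g) *
        pairing (tfShift (latticePt a n) (latticePt b m) γ) h)
      (((1 / b : ℝ) : ℂ) ^ d * ∑' j, ∫ y, gaborKernel a b g γ f h n j y) := by
  have hγc := hγ.continuous
  have hgc := hg.continuous
  have hhcont := hh.continuous
  set D : (Fin d → ℤ) → ℂ := fun m =>
    pairing (tfShift (latticePt a n) (latticePt b m) γ) h with hD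
  set F : (Fin d → ℝ) → ℂ := fun x => f x * conj (g (x - latticePt a n))
  set K : (Fin d → ℝ) → ℂ := fun y => γ (y - latticePt a n) * conj (h y)
  have hDsum : ∑' m, ‖D m‖ₑ ≠ ∞ := by
    have := tsum_enorm_pairing_test_ne_top hγ hh hhc ha hb
    rw [ENNReal.tsum_prod (f := fun n m =>
      ‖pairing (tfShift (latticePt a n) (latticePt b m) γ) h‖ₑ)] at this
    exact ENNReal.ne_top_of_tsum_ne_top this n
  have hKD : ∀ l : Fin d → ℤ, ∫ y, K y * conj (chr (latticePt b l) y) = D (-l) := fun l => by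
    simp only [hD, pairing, tfShift_apply, latticePt_neg, chr_neg_left, K]
    congr 1; ext y; ring
  have hKc : Continuous K := by fun_prop
  have hKs : HasCompactSupport K :=
    HasCompactSupport.mul_left (hhc.comp_left (g := conj) (map_zero _))
  -- Poisson summation for `K` over `(1/b)ℤ^d`. By `hKD` the Fourier samples of `K` are `D (-l)`, so
  -- the index is negated.
  have hP : ∀ x, HasSum (fun m => D m * conj (chr (latticePt b m) x))
      (((1 / b : ℝ) : ℂ) ^ d * ∑' j, K (x + latticePt (1 / b) j)) := fun x => by
    have := poisson (N := d + 1) (by omega) hKc (HasDecay.of_hasCompactSupport _ hKc hKs)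
      (one_div_pos.2 hb) (by
        simp only [one_div_one_div, hKD]
        exact (Equiv.neg (Fin d → ℤ)).summable_iff.2 (summable_of_tsum_enorm_ne_top hDsum).of_norm) x
    simp only [one_div_one_div, hKD] at this
    rw [← (Equiv.neg (Fin d → ℤ)).hasSum_iff]
    refine this.congr_fun fun l => ?_
    simp [latticePt_neg, chr_neg_left]
  have hFm : AEStronglyMeasurable F volume :=
    hf.mul (Continuous.aestronglyMeasurable (by fun_prop))
  have hFfin : ∫⁻ x, ‖F x‖ₑ ≠ ∞ := by
    obtain ⟨C, hC, hle⟩ := (hg.hasDecay (d + 1)).exists_lintegral_mul_tfShift_le (by omega) hf hfA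
    have := hle (latticePt a n) 0
    simp only [tfShift_apply, chr_zero_left, one_mul] at this
    exact ne_top_of_le_ne_top hC this
  have h1 := hasSum_integral_of_tsum_lintegral_ne_top (μ := volume)
    (F := fun m x => F x * (D m * conj (chr (latticePt b m) x)))
    (fun m => hFm.mul (Continuous.aestronglyMeasurable (by fun_prop))) (by
      simp only [enorm_mul, RCLike.enorm_conj, enorm_chr, mul_one]
      simp_rw [lintegral_mul_const' _ _ enorm_ne_top, ENNReal.tsum_mul_left]
      simpa only [enorm_mul] using ENNReal.mul_ne_top hFfin hDsum)
  have h2 : ∀ m, ∫ x, F x * (D m * conj (chr (latticePt b m) x)) =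
      pairing f (tfShift (latticePt a n) (latticePt b m) g) * D m := fun m => by
    unfold pairing
    rw [← integral_mul_const]
    congr 1; ext x
    simp only [tfShift_apply, map_mul, F]; ring
  simp_rw [h2, tsum_mul_left, (hP _).tsum_eq] at h1
  have hshift : ∀ j, (fun y => gaborKernel a b g γ f h n j y) =
      fun y => (fun x => F x * K (x + latticePt (1 / b) j)) (y - latticePt (1 / b) j) := fun j => by
    ext y
    simp only [F, K, sub_add_cancel, gaborKernel]
  have hfin : ∑' j : Fin d → ℤ, ∫⁻ x, ‖F x * K (x + latticePt (1 / b) j)‖ₑ ≠ ∞ := by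
    have := tsum_lintegral_gaborKernel_ne_top hγ hg hf hfA hhcont hhc ha hb
    rw [ENNReal.tsum_prod (f := fun n j => ∫⁻ y, ‖gaborKernel a b g γ f h n j y‖ₑ)] at this
    have := ENNReal.ne_top_of_tsum_ne_top this n
    refine ne_top_of_le_ne_top this (ENNReal.tsum_le_tsum fun j => le_of_eq ?_)
    rw [← lintegral_sub_right_eq_self _ (latticePt (1 / b) j)]
    refine lintegral_congr fun y => ?_
    rw [congr_fun (hshift j) y]
  have h3 := hasSum_integral_of_tsum_lintegral_ne_top (μ := volume)
    (F := fun (j : Fin d → ℤ) x => F x * K (x + latticePt (1 / b) j))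
    (fun m => hFm.mul (Continuous.aestronglyMeasurable (by fun_prop))) hfin
  have h4 : ∑' j, ∫ y, gaborKernel a b g γ f h n j y =
      ∫ x, ∑' j : Fin d → ℤ, F x * K (x + latticePt (1 / b) j) := by
    rw [← h3.tsum_eq]
    refine tsum_congr fun j => ?_
    rw [hshift j]
    exact integral_sub_right_eq_self (fun x => F x * K (x + latticePt (1 / b) j)) _
  rw [h4, ← integral_const_mul]
  simp_rw [tsum_mul_left]
  convert! h1 using 3
  ring

/-- Summation over the translations in the Gabor series. -/
theorem hasSum_translations (hγ : IsSynthesis φ c γ) (hg : IsSynthesis ψ e g)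
    (hf : AEStronglyMeasurable f volume) (hfA : amalgamENorm 1 ∞ f ≠ ∞)
    (hh : ContDiff ℝ (⊤ : ℕ∞) h) (hhc : HasCompactSupport h) (ha : 0 < a) (hb : 0 < b)
    (j : Fin d → ℤ) :
    HasSum (fun l : Fin d → ℤ =>
      windowedFourier g γ (tfLattice (1 / b) (1 / a) (j, l)) *
        pairing (tfShift (latticePt (1 / b) j) (latticePt (1 / a) l) f) h)
      ((a : ℂ) ^ d * ∑' n, ∫ y, gaborKernel a b g γ f h n j y) := by
  have hγc := hγ.continuous
  have hgc := hg.continuous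
  have hhcont := hh.continuous
  set V : (Fin d → ℤ) → ℂ := fun l => windowedFourier g γ (tfLattice (1 / b) (1 / a) (j, l)) with hV
  set F : (Fin d → ℝ) → ℂ := fun y => f (y - latticePt (1 / b) j) * conj (h y)
  set H : (Fin d → ℝ) → ℂ := fun y => γ y * conj (g (y - latticePt (1 / b) j))
  have hVsum : ∑' l, ‖V l‖ₑ ≠ ∞ := by
    have := (hγ.hasDecay_windowedFourier hg (2 * d + 1)).tsum_ne_top
      (tsum_wt_prod_ne_top (by omega)) (lt_min (one_div_pos.2 hb) (one_div_pos.2 ha))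
      (isLatticeMap_tfLattice (one_div_pos.2 hb) (one_div_pos.2 ha))
    rw [ENNReal.tsum_prod (f := fun j l =>
      ‖windowedFourier g γ (tfLattice (1 / b) (1 / a) (j, l))‖ₑ)] at this
    exact ENNReal.ne_top_of_tsum_ne_top this j
  have hHV : ∀ l : Fin d → ℤ, ∫ y, H y * conj (chr (latticePt (1 / a) l) y) = V l := fun l => by
    simp only [hV, windowedFourier, tfLattice, pairing, tfShift_apply, map_mul, H]
    congr 1; ext y; ring
  have hHc : Continuous H := by fun_prop
  have hHd : HasDecay (d + 1) H := by
    obtain ⟨ν, hν, hle⟩ := hγ.hasDecay (d + 1)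
    obtain ⟨B, hB⟩ := (hg.hasDecay (d + 1)).exists_bound
    refine HasDecay.of_le_lintegral (μ := ν) (π := id) (C := B) measurable_id fun z => ?_
    rw [lintegral_const_mul' _ _ ENNReal.ofReal_ne_top, mul_comm, enorm_mul, RCLike.enorm_conj]
    refine mul_le_mul' (hle z) ?_
    rw [← ofReal_norm]
    exact ENNReal.ofReal_le_ofReal (hB _)
  -- Poisson summation for `H = γ · conj (T_{j/b} g)` over `aℤ^d`; its Fourier samples are the
  -- windowed transform on the adjoint lattice.
  have hP : ∀ x, HasSum (fun l => V l * chr (latticePt (1 / a) l) x)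
      ((a : ℂ) ^ d * ∑' n, H (x + latticePt a n)) := fun x => by
    have := poisson (N := d + 1) (by omega) hHc hHd ha (by
        simp only [hHV]
        exact (summable_of_tsum_enorm_ne_top hVsum).of_norm) x
    simpa only [hHV] using this
  have htr : AEStronglyMeasurable (transl (latticePt (1 / b) j) f) volume :=
    hf.comp_quasiMeasurePreserving
      (measurePreserving_sub_right volume _).quasiMeasurePreserving
  have hFm : AEStronglyMeasurable F volume :=
    htr.mul (Continuous.aestronglyMeasurable (by fun_prop))
  have hFfin : ∫⁻ x, ‖F x‖ₑ ≠ ∞ := by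
    obtain ⟨C, hC, hle⟩ := (HasDecay.of_hasCompactSupport (d + 1) hhcont
      hhc).exists_lintegral_mul_tfShift_le (by omega) hf hfA
    refine ne_top_of_le_ne_top hC (le_trans (le_of_eq ?_) (hle (-latticePt (1 / b) j) 0))
    rw [← lintegral_sub_right_eq_self
      (fun x => ‖f x * conj (tfShift (-latticePt (1 / b) j) 0 h x)‖ₑ) (latticePt (1 / b) j)]
    refine lintegral_congr fun y => ?_
    simp only [F, tfShift_apply, chr_zero_left, one_mul, sub_neg_eq_add, sub_add_cancel]
  have h1 := hasSum_integral_of_tsum_lintegral_ne_top (μ := volume)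
    (F := fun l x => F x * (V l * chr (latticePt (1 / a) l) x))
    (fun m => hFm.mul (Continuous.aestronglyMeasurable (by fun_prop))) (by
      simp only [enorm_mul, enorm_chr, mul_one]
      simp_rw [lintegral_mul_const' _ _ enorm_ne_top, ENNReal.tsum_mul_left]
      simpa only [enorm_mul] using ENNReal.mul_ne_top hFfin hVsum)
  have h2 : ∀ l, ∫ x, F x * (V l * chr (latticePt (1 / a) l) x) =
      V l * pairing (tfShift (latticePt (1 / b) j) (latticePt (1 / a) l) f) h := fun l => by
    unfold pairing
    rw [← integral_const_mul]
    congr 1; ext x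
    simp only [tfShift_apply, F]; ring
  simp_rw [h2, tsum_mul_left, (hP _).tsum_eq] at h1
  have hker : ∀ n x, F x * H (x + latticePt a (-n)) = gaborKernel a b g γ f h n j x := fun n x => by
    simp only [F, H, gaborKernel, latticePt_neg, ← sub_eq_add_neg, sub_right_comm]
    ring
  have h3 := hasSum_integral_of_tsum_lintegral_ne_top (μ := volume)
    (F := fun n => gaborKernel a b g γ f h n j)
    (fun n => aestronglyMeasurable_gaborKernel hγ hg hf hhcont n j) (by
      have := tsum_lintegral_gaborKernel_ne_top hγ hg hf hfA hhcont hhc ha hb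
      rw [ENNReal.tsum_prod (f := fun n j => ∫⁻ y, ‖gaborKernel a b g γ f h n j y‖ₑ),
        ENNReal.tsum_comm] at this
      exact ENNReal.ne_top_of_tsum_ne_top this j)
  rw [h3.tsum_eq, ← integral_const_mul]
  have hsum : ∀ x, ∑' n, gaborKernel a b g γ f h n j x = F x * ∑' n, H (x + latticePt a n) :=
    fun x => by
      rw [tsum_congr fun n => (hker n x).symm, tsum_mul_left,
        tsum_comp_neg fun n => H (x + latticePt a n)]
  simp_rw [hsum]
  convert! h1 using 3
  ring

theorem summable_janssen (hγ : IsSynthesis φ c γ) (hg : IsSynthesis ψ e g)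
    (hf : AEStronglyMeasurable f volume) (hfA : amalgamENorm 1 ∞ f ≠ ∞)
    (hh : ContDiff ℝ (⊤ : ℕ∞) h) (hhc : HasCompactSupport h) (ha : 0 < a) (hb : 0 < b) :
    Summable fun k : (Fin d → ℤ) × (Fin d → ℤ) =>
      windowedFourier g γ (tfLattice (1 / b) (1 / a) k) *
        pairing (tfShift (latticePt (1 / b) k.1) (latticePt (1 / a) k.2) f) h := by
  obtain ⟨C, hC, hle⟩ := (HasDecay.of_hasCompactSupport (d + 1) hh.continuous
    hhc).exists_lintegral_mul_tfShift_le (by omega) hf hfA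
  have hV := (hγ.hasDecay_windowedFourier hg (2 * d + 1)).tsum_ne_top
      (tsum_wt_prod_ne_top (by omega)) (lt_min (one_div_pos.2 hb) (one_div_pos.2 ha))
      (isLatticeMap_tfLattice (one_div_pos.2 hb) (one_div_pos.2 ha))
  refine (summable_of_tsum_enorm_ne_top (ne_top_of_le_ne_top (ENNReal.mul_ne_top hV hC) ?_)).of_norm
  rw [← ENNReal.tsum_mul_right]
  refine ENNReal.tsum_le_tsum fun k => ?_
  rw [enorm_mul]
  refine mul_le_mul_right ?_ _
  rw [norm_pairing_comm, enorm_pairing_tfShift_right, norm_pairing_comm]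
  exact (enorm_integral_le_lintegral_enorm _).trans (hle _ _)

/-- The fundamental identity of Gabor analysis (Janssen's representation), in the weak sense. -/
theorem hasSum_gabor (hγ : IsSynthesis φ c γ) (hg : IsSynthesis ψ e g)
    (hf : AEStronglyMeasurable f volume) (hfA : amalgamENorm 1 ∞ f ≠ ∞)
    (hh : ContDiff ℝ (⊤ : ℕ∞) h) (hhc : HasCompactSupport h) (ha : 0 < a) (hb : 0 < b) :
    HasSum (fun nm : (Fin d → ℤ) × (Fin d → ℤ) => ((a * b : ℝ) : ℂ) ^ d *
      (pairing f (tfShift (latticePt a nm.1) (latticePt b nm.2) g) *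
        pairing (tfShift (latticePt a nm.1) (latticePt b nm.2) γ) h))
      (∑' k : (Fin d → ℤ) × (Fin d → ℤ), windowedFourier g γ (tfLattice (1 / b) (1 / a) k) *
        pairing (tfShift (latticePt (1 / b) k.1) (latticePt (1 / a) k.2) f) h) := by
  have hL : Summable fun nm : (Fin d → ℤ) × (Fin d → ℤ) =>
      pairing f (tfShift (latticePt a nm.1) (latticePt b nm.2) g) *
        pairing (tfShift (latticePt a nm.1) (latticePt b nm.2) γ) h := by
    obtain ⟨C, hC, hle⟩ := (hg.hasDecay (d + 1)).exists_lintegral_mul_tfShift_le (by omega) hf hfA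
    refine (summable_of_tsum_enorm_ne_top (ne_top_of_le_ne_top (ENNReal.mul_ne_top hC
      (tsum_enorm_pairing_test_ne_top hγ hh hhc ha hb)) ?_)).of_norm
    rw [← ENNReal.tsum_mul_left]
    refine ENNReal.tsum_le_tsum fun k => ?_
    rw [enorm_mul]
    exact mul_le_mul_left ((enorm_integral_le_lintegral_enorm _).trans (hle _ _)) _
  have hI : Summable fun nj : (Fin d → ℤ) × (Fin d → ℤ) =>
      ∫ y, gaborKernel a b g γ f h nj.1 nj.2 y :=
    (summable_of_tsum_enorm_ne_top (ne_top_of_le_ne_top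
      (tsum_lintegral_gaborKernel_ne_top hγ hg hf hfA hh.continuous hhc ha hb)
      (ENNReal.tsum_le_tsum fun k => enorm_integral_le_lintegral_enorm _))).of_norm
  have ha' : (a : ℂ) ≠ 0 := by exact_mod_cast ha.ne'
  have hb' : (b : ℂ) ≠ 0 := by exact_mod_cast hb.ne'
  have e1 : ∑' nm : (Fin d → ℤ) × (Fin d → ℤ),
      pairing f (tfShift (latticePt a nm.1) (latticePt b nm.2) g) *
        pairing (tfShift (latticePt a nm.1) (latticePt b nm.2) γ) h =
      ((1 / b : ℝ) : ℂ) ^ d * ∑' n, ∑' j, ∫ y, gaborKernel a b g γ f h n j y := by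
    rw [hL.tsum_prod, ← tsum_mul_left]
    exact tsum_congr fun n => (hasSum_modulations hγ hg hf hfA hh hhc ha hb n).tsum_eq
  have e2 : ∑' k : (Fin d → ℤ) × (Fin d → ℤ), windowedFourier g γ (tfLattice (1 / b) (1 / a) k) *
        pairing (tfShift (latticePt (1 / b) k.1) (latticePt (1 / a) k.2) f) h =
      (a : ℂ) ^ d * ∑' j, ∑' n, ∫ y, gaborKernel a b g γ f h n j y := by
    rw [(summable_janssen hγ hg hf hfA hh hhc ha hb).tsum_prod, ← tsum_mul_left]
    exact tsum_congr fun j => (hasSum_translations hγ hg hf hfA hh hhc ha hb j).tsum_eq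
  -- Both sides are now iterated sums of one absolutely summable family, and the normalizations
  -- agree since `(ab)^d b^{-d} = a^d`.
  have e3 : ∑' n, ∑' j, ∫ y, gaborKernel a b g γ f h n j y =
      ∑' j, ∑' n, ∫ y, gaborKernel a b g γ f h n j y := hI.tsum_comm.symm
  have := hL.hasSum.mul_left (((a * b : ℝ) : ℂ) ^ d)
  rw [e1, e3] at this
  rw [e2]
  convert! this using 1
  rw [← mul_assoc, ← mul_pow]
  congr 2
  push_cast
  field_simp

end Janssen

/-! ### Gabor frame operators with windows in Feichtinger's algebra -/

theorem not_ae_eq_zero_left {γ g : (Fin d → ℝ) → ℂ} (h : pairing γ g ≠ 0) :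
    ¬ γ =ᵐ[volume] 0 := fun h0 => h <| by
  rw [pairing_congr_ae h0 (ae_eq_refl g)]
  simp [pairing]

theorem pairing_swap_ne_zero {γ g : (Fin d → ℝ) → ℂ} (h : pairing γ g ≠ 0) : pairing g γ ≠ 0 := by
  rw [← pairing_conj]
  exact (map_ne_zero _).2 h

/-- A nonzero pairing rules out null windows, so both have synthesized representatives; pairings do
not see the change on a null set. -/
theorem MemS0.hasDecay_windowedFourier {g γ : (Fin d → ℝ) → ℂ} (hg : MemS0 g) (hγ : MemS0 γ)
    (h : pairing γ g ≠ 0) (N : ℕ) : HasDecay N (windowedFourier g γ) := by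
  obtain ⟨φ, c, γ', hγ', e⟩ := hγ.exists_isSynthesis (not_ae_eq_zero_left h)
  obtain ⟨ψ, c', g', hg', e'⟩ :=
    hg.exists_isSynthesis (not_ae_eq_zero_left (pairing_swap_ne_zero h))
  have : windowedFourier g γ = windowedFourier g' γ' := by
    ext z; exact pairing_congr_ae e (tfShift_congr_ae _ _ e')
  rw [this]
  exact hγ'.hasDecay_windowedFourier hg' N

theorem MemS0.hasSum_gabor {g γ f h : (Fin d → ℝ) → ℂ} (hg : MemS0 g) (hγ : MemS0 γ)
    (hgγ : pairing γ g ≠ 0) (hf : AEStronglyMeasurable f volume) (hfA : amalgamENorm 1 ∞ f ≠ ∞)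
    (hh : ContDiff ℝ (⊤ : ℕ∞) h) (hhc : HasCompactSupport h) {a b : ℝ} (ha : 0 < a) (hb : 0 < b) :
    HasSum (fun nm : (Fin d → ℤ) × (Fin d → ℤ) => ((a * b : ℝ) : ℂ) ^ d *
      (pairing f (tfShift (latticePt a nm.1) (latticePt b nm.2) g) *
        pairing (tfShift (latticePt a nm.1) (latticePt b nm.2) γ) h))
      (∑' k : (Fin d → ℤ) × (Fin d → ℤ), windowedFourier g γ (tfLattice (1 / b) (1 / a) k) *
        pairing (tfShift (latticePt (1 / b) k.1) (latticePt (1 / a) k.2) f) h) := by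
  obtain ⟨φ, c, γ', hγ', e⟩ := hγ.exists_isSynthesis (not_ae_eq_zero_left hgγ)
  obtain ⟨ψ, c', g', hg', e'⟩ :=
    hg.exists_isSynthesis (not_ae_eq_zero_left (pairing_swap_ne_zero hgγ))
  have h1 : windowedFourier g γ = windowedFourier g' γ' := by
    ext z; exact pairing_congr_ae e (tfShift_congr_ae _ _ e')
  have h2 : ∀ t ω, pairing f (tfShift t ω g) = pairing f (tfShift t ω g') := fun t ω =>
    pairing_congr_ae (ae_eq_refl f) (tfShift_congr_ae _ _ e')
  have h3 : ∀ t ω, pairing (tfShift t ω γ) h = pairing (tfShift t ω γ') h := fun t ω =>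
    pairing_congr_ae (tfShift_congr_ae _ _ e) (ae_eq_refl h)
  simp only [h1, h2, h3]
  exact Gabor.hasSum_gabor hγ' hg' hf hfA hh hhc ha hb

section Operators

variable {p q : ℝ≥0∞} [Fact (1 ≤ p)] [Fact (1 ≤ q)] {g γ : (Fin d → ℝ) → ℂ} {a b : ℝ}

/-- The terms of Janssen's representation of the Gabor frame operator. -/
noncomputable def janssenTerm (p q : ℝ≥0∞) [Fact (1 ≤ p)] [Fact (1 ≤ q)] (a b : ℝ)
    (g γ : (Fin d → ℝ) → ℂ) (k : (Fin d → ℤ) × (Fin d → ℤ)) :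
    Amalgam d p q →L[ℂ] Amalgam d p q :=
  ((pairing γ g)⁻¹ * windowedFourier g γ (tfLattice (1 / b) (1 / a) k)) •
    tfShiftCLM p q (latticePt (1 / b) k.1) (latticePt (1 / a) k.2)

theorem enorm_janssenTerm_le (k : (Fin d → ℤ) × (Fin d → ℤ)) :
    ‖janssenTerm p q a b g γ k‖ₑ ≤
      (2 ^ d * ‖(pairing γ g)⁻¹‖ₑ) * ‖windowedFourier g γ (tfLattice (1 / b) (1 / a) k)‖ₑ := by
  rw [janssenTerm, enorm_smul, enorm_mul, mul_comm (2 ^ d), mul_right_comm]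
  gcongr
  rw [← _root_.ofReal_norm]
  refine (ENNReal.ofReal_le_ofReal (norm_tfShiftCLM_le _ _)).trans (le_of_eq ?_)
  rw [ENNReal.ofReal_pow (by norm_num), ENNReal.ofReal_ofNat]

theorem janssenTerm_zero (h : pairing γ g ≠ 0) :
    janssenTerm p q a b g γ 0 = ContinuousLinearMap.id ℂ (Amalgam d p q) := by
  have h0 : windowedFourier g γ (tfLattice (1 / b) (1 / a) 0) = pairing γ g := by
    simp only [windowedFourier, tfLattice, Prod.fst_zero, Prod.snd_zero, latticePt_zero]
    congr 1; ext x; simp [tfShift_apply]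
  rw [janssenTerm, h0, inv_mul_cancel₀ h, one_smul]
  simp only [Prod.fst_zero, Prod.snd_zero, latticePt_zero]
  exact tfShiftCLM_zero

theorem tsum_enorm_janssenTerm_ne_top (hg : MemS0 g) (hγ : MemS0 γ) (h : pairing γ g ≠ 0)
    (ha : 0 < a) (hb : 0 < b) : ∑' k, ‖janssenTerm p q a b g γ k‖ₑ ≠ ∞ := by
  have hV := (hg.hasDecay_windowedFourier hγ h (2 * d + 1)).tsum_ne_top
      (tsum_wt_prod_ne_top (by omega)) (lt_min (one_div_pos.2 hb) (one_div_pos.2 ha))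
      (isLatticeMap_tfLattice (one_div_pos.2 hb) (one_div_pos.2 ha))
  refine ne_top_of_le_ne_top (ENNReal.mul_ne_top (a := 2 ^ d * ‖(pairing γ g)⁻¹‖ₑ)
    (ENNReal.mul_ne_top (by simp) enorm_ne_top) hV) ?_
  rw [← ENNReal.tsum_mul_left]
  exact ENNReal.tsum_le_tsum enorm_janssenTerm_le

theorem summable_janssenTerm (hg : MemS0 g) (hγ : MemS0 γ) (h : pairing γ g ≠ 0)
    (ha : 0 < a) (hb : 0 < b) : Summable (janssenTerm p q a b g γ) := by
  have := ENNReal.summable_toReal (tsum_enorm_janssenTerm_ne_top (p := p) (q := q) hg hγ h ha hb)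
  simp only [toReal_enorm] at this
  exact this.of_norm

/-- Pairing with a test function is a continuous functional, so it passes through the
norm-convergent sum and turns it into the right side of `MemS0.hasSum_gabor`. -/
theorem isGaborFrameOperator_tsum_janssenTerm (hg : MemS0 g) (hγ : MemS0 γ) (h : pairing γ g ≠ 0)
    (ha : 0 < a) (hb : 0 < b) :
    IsGaborFrameOperator a b g γ (∑' k, janssenTerm p q a b g γ k) := by
  intro f φ hφ hφc
  obtain ⟨L, hL⟩ := Amalgam.exists_pairingCLM (p := p) (q := q) hφ.continuous hφc
  have h1 : HasSum (fun k => L (janssenTerm p q a b g γ k f))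
      (L ((∑' k, janssenTerm p q a b g γ k) f)) :=
    (summable_janssenTerm hg hγ h ha hb).hasSum.mapL
      (L.comp (ContinuousLinearMap.apply ℂ (Amalgam d p q) f))
  have h2 : ∀ k, L (janssenTerm p q a b g γ k f) = (pairing γ g)⁻¹ *
      (windowedFourier g γ (tfLattice (1 / b) (1 / a) k) *
        pairing (tfShift (latticePt (1 / b) k.1) (latticePt (1 / a) k.2) (rep f)) φ) := fun k => by
    rw [janssenTerm, _root_.smul_apply, map_smul, hL, smul_eq_mul, mul_assoc,
      pairing_congr_ae (rep_tfShiftCLM _ _ f) (ae_eq_refl φ)]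
  have h3 := (hg.hasSum_gabor hγ h (Amalgam.aestronglyMeasurable f)
    (Amalgam.amalgamENorm_one_top_ne_top f) hφ hφc ha hb).mul_left (pairing γ g)⁻¹
  rw [hL] at h1
  simp only [h2] at h1
  rw [← tsum_mul_left, h1.tsum_eq] at h3
  refine h3.congr_fun fun nm => ?_
  rw [div_eq_inv_mul, mul_assoc]

theorem IsGaborFrameOperator.unique {S T : Amalgam d p q →L[ℂ] Amalgam d p q}
    (hS : IsGaborFrameOperator a b g γ S) (hT : IsGaborFrameOperator a b g γ T) : S = T :=
  ContinuousLinearMap.ext fun f => Amalgam.ext_of_pairing fun φ hφ hφc =>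
    (hS f φ hφ hφc).unique (hT f φ hφ hφc)

theorem existsUnique_isGaborFrameOperator (hg : MemS0 g) (hγ : MemS0 γ) (h : pairing γ g ≠ 0)
    (ha : 0 < a) (hb : 0 < b) :
    ∃! S : Amalgam d p q →L[ℂ] Amalgam d p q, IsGaborFrameOperator a b g γ S :=
  ⟨_, isGaborFrameOperator_tsum_janssenTerm hg hγ h ha hb,
    fun _ hS => hS.unique (isGaborFrameOperator_tsum_janssenTerm hg hγ h ha hb)⟩

theorem gaborFrameOperator_eq_tsum (hg : MemS0 g) (hγ : MemS0 γ) (h : pairing γ g ≠ 0)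
    (ha : 0 < a) (hb : 0 < b) :
    gaborFrameOperator p q a b g γ = ∑' k, janssenTerm p q a b g γ k :=
  (Classical.epsilon_spec (p := IsGaborFrameOperator a b g γ)
    ⟨_, isGaborFrameOperator_tsum_janssenTerm hg hγ h ha hb⟩).unique
    (isGaborFrameOperator_tsum_janssenTerm hg hγ h ha hb)

theorem enorm_tsum_sub_le {ι E : Type*} [NormedAddCommGroup E] [CompleteSpace E] {f : ι → E}
    (hf : Summable f) (i : ι) : ‖∑' k, f k - f i‖ₑ ≤ ∑' k : {k // k ≠ i}, ‖f k‖ₑ := by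
  have e : ∑' k, f k - f i = ∑' k : {k // k ≠ i}, f k := by
    rw [← hf.tsum_subtype_add_tsum_subtype_compl {i}, tsum_singleton, add_sub_cancel_left]
    rfl
  rw [e]
  exact enorm_tsum_le_tsum_enorm

/-- Subtracting the identity removes exactly the term of Janssen's series at the origin. -/
theorem enorm_gaborFrameOperator_sub_id_le (hg : MemS0 g) (hγ : MemS0 γ) (h : pairing γ g ≠ 0)
    (ha : 0 < a) (hb : 0 < b) :
    ‖gaborFrameOperator p q a b g γ - ContinuousLinearMap.id ℂ (Amalgam d p q)‖ₑ ≤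
      (2 ^ d * ‖(pairing γ g)⁻¹‖ₑ) * ∑' k : {k : (Fin d → ℤ) × (Fin d → ℤ) // k ≠ 0},
        ‖windowedFourier g γ (tfLattice (1 / b) (1 / a) k)‖ₑ := by
  have hs := summable_janssenTerm (p := p) (q := q) hg hγ h ha hb
  rw [gaborFrameOperator_eq_tsum hg hγ h ha hb,
    ← janssenTerm_zero (p := p) (q := q) (a := a) (b := b) h, ← ENNReal.tsum_mul_left]
  exact (enorm_tsum_sub_le hs 0).trans (ENNReal.tsum_le_tsum fun k => enorm_janssenTerm_le _)

theorem eventually_pos_pos : ∀ᶠ ab : ℝ × ℝ in 𝓝[>] 0 ×ˢ 𝓝[>] 0, 0 < ab.1 ∧ 0 < ab.2 :=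
  (eventually_mem_nhdsWithin (a := (0 : ℝ)) (s := Set.Ioi 0)).prod_mk
    (eventually_mem_nhdsWithin (a := (0 : ℝ)) (s := Set.Ioi 0))

theorem tendsto_gaborFrameOperator (hg : MemS0 g) (hγ : MemS0 γ) (h : pairing γ g ≠ 0) :
    Tendsto (fun ab : ℝ × ℝ => gaborFrameOperator p q ab.1 ab.2 g γ)
      (𝓝[>] 0 ×ˢ 𝓝[>] 0) (𝓝 (ContinuousLinearMap.id ℂ (Amalgam d p q))) := by
  rw [tendsto_iff_edist_tendsto_0]
  have h1 := ENNReal.Tendsto.const_mul (a := 2 ^ d * ‖(pairing γ g)⁻¹‖ₑ)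
    ((hg.hasDecay_windowedFourier hγ h (2 * d + 1)).tendsto_tsum_ne_zero (by omega))
    (Or.inr (ENNReal.mul_ne_top (by simp) enorm_ne_top))
  rw [mul_zero] at h1
  refine tendsto_of_tendsto_of_tendsto_of_le_of_le' tendsto_const_nhds h1
    (Eventually.of_forall fun _ => zero_le) ?_
  filter_upwards [eventually_pos_pos] with ab hab
  rw [edist_eq_enorm_sub]
  exact enorm_gaborFrameOperator_sub_id_le hg hγ h hab.1 hab.2

theorem tendsto_pairing_modul_transl (hg : MemS0 g) (hγ : MemS0 γ) (h : pairing γ g ≠ 0)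
    (l n : Fin d → ℤ) :
    Tendsto (fun ab : ℝ × ℝ => (pairing γ g)⁻¹ *
        pairing γ (modul (latticePt (1 / ab.1) l) (transl (latticePt (1 / ab.2) n) g)))
      (𝓝[>] 0 ×ˢ 𝓝[>] 0) (𝓝 ((if l = 0 then 1 else 0) * (if n = 0 then 1 else 0))) := by
  by_cases hk : (n, l) = 0
  · obtain ⟨rfl, rfl⟩ := Prod.mk_eq_zero.1 hk
    refine tendsto_const_nhds.congr fun ab => ?_
    have h0 : modul (latticePt (1 / ab.1) 0) (transl (latticePt (1 / ab.2) 0) g) = g := by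
      ext x
      rw [latticePt_zero, latticePt_zero]
      change tfShift 0 0 g x = g x
      simp [tfShift_apply]
    rw [h0, inv_mul_cancel₀ h]
    simp
  · have h0 : ((if l = 0 then 1 else 0) * (if n = 0 then 1 else 0) : ℂ) = 0 := by
      by_cases hl : l = 0
      · have : n ≠ 0 := fun hn => hk (by rw [hl, hn]; rfl)
        simp [this]
      · simp [hl]
    rw [h0, ← mul_zero (pairing γ g)⁻¹]
    refine Tendsto.const_mul _ ?_
    rw [tendsto_zero_iff_enorm_tendsto_zero]
    refine tendsto_of_tendsto_of_tendsto_of_le_of_le tendsto_const_nhds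
      ((hg.hasDecay_windowedFourier hγ h (2 * d + 1)).tendsto_tsum_ne_zero (by omega))
      (fun _ => zero_le) fun ab => ?_
    -- A single off-origin coefficient is bounded by the whole off-origin sum, already known to tend
    -- to zero.
    exact ENNReal.le_tsum (f := fun k : {k : (Fin d → ℤ) × (Fin d → ℤ) // k ≠ 0} =>
      ‖windowedFourier g γ (tfLattice (1 / ab.2) (1 / ab.1) k)‖ₑ) ⟨(n, l), hk⟩

end Operators

end Gabor
theorem mainTheorem5 {d : ℕ} (hd : 1 ≤ d) (p q : ℝ≥0∞) [Fact (1 ≤ p)] [Fact (1 ≤ q)]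
    (g γ : (Fin d → ℝ) → ℂ) (hg : Gabor.MemS0 g) (hγ : Gabor.MemS0 γ)
    (hgγ : Gabor.pairing γ g ≠ 0)
    (hR : Gabor.LocallyRiemannIntegrable fun x => conj (g x) * γ x) :
    (∀ a b : ℝ, 0 < a → 0 < b →
      (∃! S : Gabor.Amalgam d p q →L[ℂ] Gabor.Amalgam d p q,
        Gabor.IsGaborFrameOperator a b g γ S) ∧
      (∃! S : Gabor.Amalgam d p q →L[ℂ] Gabor.Amalgam d p q,
        Gabor.IsGaborFrameOperator a b γ g S)) ∧
    ((Tendsto (fun ab : ℝ × ℝ => Gabor.gaborFrameOperator p q ab.1 ab.2 g γ)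
          (𝓝[>] 0 ×ˢ 𝓝[>] 0) (𝓝 (ContinuousLinearMap.id ℂ (Gabor.Amalgam d p q))) ∧
        Tendsto (fun ab : ℝ × ℝ => Gabor.gaborFrameOperator p q ab.1 ab.2 γ g)
          (𝓝[>] 0 ×ˢ 𝓝[>] 0) (𝓝 (ContinuousLinearMap.id ℂ (Gabor.Amalgam d p q)))) ↔
      ∀ l n : Fin d → ℤ,
        Tendsto (fun ab : ℝ × ℝ => (Gabor.pairing γ g)⁻¹ *
            Gabor.pairing γ (Gabor.modul (Gabor.latticePt (1 / ab.1) l)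
              (Gabor.transl (Gabor.latticePt (1 / ab.2) n) g)))
          (𝓝[>] 0 ×ˢ 𝓝[>] 0)
          (𝓝 ((if l = 0 then 1 else 0) * (if n = 0 then 1 else 0)))) := by

  have hγg := Gabor.pairing_swap_ne_zero hgγ
  -- Each side of the equivalence is established outright. The operator with interchanged windows is
  -- covered by symmetry, its normalizing factor being the conjugate of `⟨γ, g⟩`.
  refine ⟨fun a b ha hb => ⟨Gabor.existsUnique_isGaborFrameOperator hg hγ hgγ ha hb,
    Gabor.existsUnique_isGaborFrameOperator hγ hg hγg ha hb⟩, fun _ l n => ?_, fun _ => ⟨?_, ?_⟩⟩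
  · exact Gabor.tendsto_pairing_modul_transl hg hγ hgγ l n
  · exact Gabor.tendsto_gaborFrameOperator hg hγ hgγ
  · exact Gabor.tendsto_gaborFrameOperator hγ hg hγg
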